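/- **Definitions.** A *geometric graph* $G=(P,E)$ consists of a finite set $P\subset\mathbb{R}^2$ of (pairwise distinct) points, its vertices, and a finite set $E$ of line segments joining two distinct points of $P$, its edges (each segment being identified with the unordered pair of its endpoints). It is *rooted* if one vertex $r\in P$ is designated as its root. A path $(w_0,\dots,w_l)$ of $G$ is *monotone* with respect to an axis $y'$ if $y'(w_0)\le y'(w_1)\le\dots\le y'(w_l)$ or $y'(w_0)\ge y'(w_1)\ge\dots\ge y'(w_l)$, where $y'(p)$ denotes the coordinate of $p$ along $y'$. For a Cartesian system $x'y'$ (a pair of perpendicular axes), the path is $x'y'$-monotone if it is monotone with respect to both $x'$ and $y'$. A geometric graph $G$ with root $r$ is *rooted uniform 2D-monotone* if there is one Cartesian system $x'y'$ such that every vertex $p\in P$ is joined to $r$ by an $x'y'$-monotone path of $G$. **Model of computation.** A real RAM with unit cost per operation: a program is one fixed finite program, built from assignments, sequencing, conditionals and while-loops, that works on registers and arrays of natural numbers and of real numbers. The operations are: addition, truncated subtraction and comparison of natural numbers; the four arithmetic operations and comparison of real numbers; integer constants; Boolean combinations of tests; array access with a natural number index. (There are no roots, trigonometric functions or rounding.)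 The input consists of $|P|$, $|E|$, the coordinates of the points, numbered $0,\dots,|P|-1$ in any order, the number of the root, and an array listing, for every edge, in any order, the numbers of its two endpoints; the rest of the memory is initially zero. **Theorem.** There are a real RAM program and a constant $C$ such that, for every rooted connected geometric graph $G=(P,E)$ and every such listing of it as input, the program halts and correctly outputs whether $G$ is rooted uniform 2D-monotone, and it does so after at most $C\,|E|\log|P|$ steps whenever $|P|\ge 2$. -/

import Mathlib

/-! ### Rooted uniform 2D-monotone geometric graphs -/

namespace Geom

/-- The Euclidean plane. -/
abbrev Plane : Type := EuclideanSpace ℝ (Fin 2)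

/-- A pair of perpendicular axes `x'`, `y'`, given by their (unit) directions `b 0`, `b 1`. The
origin does not matter for monotonicity, since moving it shifts each coordinate by a constant. -/
abbrev CartesianSystem : Type := OrthonormalBasis (Fin 2) ℝ Plane

/-- The `x'`-coordinate (`k = 0`) or `y'`-coordinate (`k = 1`) of `p` in a Cartesian system. -/
noncomputable def coord (b : CartesianSystem) (k : Fin 2) (p : Plane) : ℝ := b.repr p k

/-- The sequence `w₀, w₁, …, w_l` of points is monotone with respect to the coordinate `c`:
either `c w₀ ≤ c w₁ ≤ … ≤ c w_l` or `c w₀ ≥ c w₁ ≥ … ≥ c w_l`. -/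
def MonotoneSeq (c : Plane → ℝ) (W : List Plane) : Prop :=
  W.IsChain (fun p q => c p ≤ c q) ∨ W.IsChain (fun p q => c q ≤ c p)

/-- The sequence of points is monotone with respect to both axes of the Cartesian system. -/
def XYMonotoneSeq (b : CartesianSystem) (W : List Plane) : Prop :=
  MonotoneSeq (coord b 0) W ∧ MonotoneSeq (coord b 1) W

/-- A geometric graph on the finite point set `P`: its edges are segments joining two distinct
points of `P`; such a segment is identified with the unordered pair of its endpoints. -/
abbrev GeometricGraph (P : Finset Plane) : Type := SimpleGraph P

variable {P : Finset Plane}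

/-- The number `|E|` of edges. -/
noncomputable def numEdges (G : GeometricGraph P) : ℕ := G.edgeSet.ncard

/-- The geometric graph `G` with root `r` is rooted `x'y'`-monotone: every vertex is joined to the
root by a path of `G` that is monotone with respect to both axes. -/
def RootedXYMonotone (b : CartesianSystem) (G : GeometricGraph P) (r : P) : Prop :=
  ∀ p : P, ∃ W : G.Walk r p, W.IsPath ∧ XYMonotoneSeq b (W.support.map (fun q => (q : Plane)))

/-- The geometric graph `G` with root `r` is rooted uniform 2D-monotone: it is rooted
`x'y'`-monotone for one and the same Cartesian system `x'y'`. -/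
def RootedUniform2DMonotone (G : GeometricGraph P) (r : P) : Prop :=
  ∃ b : CartesianSystem, RootedXYMonotone b G r

end Geom

/-! ### Real RAM programs with unit-cost operations -/

namespace RealRAM

/-- The memory: registers and arrays of natural numbers (indices, counters, links), and registers
and arrays of real numbers. Registers and arrays are named by natural numbers; a (finite) program
only names finitely many of them. -/
@[ext]
structure State where
  natReg : ℕ → ℕ
  natArr : ℕ → ℕ → ℕ
  realReg : ℕ → ℝ
  realArr : ℕ → ℕ → ℝ

/-- Natural number expressions: constants, registers, array entries `A[e]`, sums, and truncated
differences. -/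
inductive NatExp where
  | const (k : ℕ)
  | reg (x : ℕ)
  | arr (a : ℕ) (e : NatExp)
  | add (e f : NatExp)
  | sub (e f : NatExp)

/-- Real number expressions: integer constants, registers, array entries `A[e]`, and the four
arithmetic operations. There is no root, no trigonometric function and no rounding. -/
inductive RealExp where
  | const (k : ℤ)
  | reg (x : ℕ)
  | arr (a : ℕ) (e : NatExp)
  | add (e f : RealExp)
  | sub (e f : RealExp)
  | mul (e f : RealExp)
  | div (e f : RealExp)

/-- Tests: comparisons of natural numbers or of real numbers, and their Boolean combinations. -/
inductive Test where
  | natLt (e f : NatExp)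
  | natEq (e f : NatExp)
  | realLt (e f : RealExp)
  | realEq (e f : RealExp)
  | not (b : Test)
  | and (b c : Test)
  | or (b c : Test)

/-- Programs. -/
inductive Program where
  | skip
  | setNat (x : ℕ) (e : NatExp)
  | setNatArr (a : ℕ) (i : NatExp) (e : NatExp)
  | setReal (x : ℕ) (e : RealExp)
  | setRealArr (a : ℕ) (i : NatExp) (e : RealExp)
  | seq (c d : Program)
  | ite (b : Test) (c d : Program)
  | loop (b : Test) (c : Program)

/-- The value of a natural number expression. -/
def NatExp.eval (s : State) : NatExp → ℕ
  | .const k => k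
  | .reg x => s.natReg x
  | .arr a e => s.natArr a (e.eval s)
  | .add e f => e.eval s + f.eval s
  | .sub e f => e.eval s - f.eval s

/-- The number of operations needed to evaluate a natural number expression. -/
def NatExp.cost : NatExp → ℕ
  | .const _ => 1
  | .reg _ => 1
  | .arr _ e => e.cost + 1
  | .add e f => e.cost + f.cost + 1
  | .sub e f => e.cost + f.cost + 1

/-- The value of a real number expression (a quotient with divisor `0` has the value `0`). -/
noncomputable def RealExp.eval (s : State) : RealExp → ℝ
  | .const k => (k : ℝ)
  | .reg x => s.realReg x
  | .arr a e => s.realArr a (e.eval s)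
  | .add e f => e.eval s + f.eval s
  | .sub e f => e.eval s - f.eval s
  | .mul e f => e.eval s * f.eval s
  | .div e f => e.eval s / f.eval s

/-- The number of operations needed to evaluate a real number expression. -/
def RealExp.cost : RealExp → ℕ
  | .const _ => 1
  | .reg _ => 1
  | .arr _ e => e.cost + 1
  | .add e f => e.cost + f.cost + 1
  | .sub e f => e.cost + f.cost + 1
  | .mul e f => e.cost + f.cost + 1
  | .div e f => e.cost + f.cost + 1

/-- The outcome of a test. -/
def Test.eval (s : State) : Test → Prop
  | .natLt e f => e.eval s < f.eval s
  | .natEq e f => e.eval s = f.eval s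
  | .realLt e f => e.eval s < f.eval s
  | .realEq e f => e.eval s = f.eval s
  | .not b => ¬ b.eval s
  | .and b c => b.eval s ∧ c.eval s
  | .or b c => b.eval s ∨ c.eval s

/-- The number of operations needed to carry out a test. -/
def Test.cost : Test → ℕ
  | .natLt e f => e.cost + f.cost + 1
  | .natEq e f => e.cost + f.cost + 1
  | .realLt e f => e.cost + f.cost + 1
  | .realEq e f => e.cost + f.cost + 1
  | .not b => b.cost + 1
  | .and b c => b.cost + c.cost + 1
  | .or b c => b.cost + c.cost + 1

/-- Store `v` in the natural number register `x`. -/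
def State.putNat (s : State) (x v : ℕ) : State :=
  { s with natReg := Function.update s.natReg x v }

/-- Store `v` in entry `i` of the array `a` of natural numbers. -/
def State.putNatArr (s : State) (a i v : ℕ) : State :=
  { s with natArr := Function.update s.natArr a (Function.update (s.natArr a) i v) }

/-- Store `v` in the real register `x`. -/
noncomputable def State.putReal (s : State) (x : ℕ) (v : ℝ) : State :=
  { s with realReg := Function.update s.realReg x v }

/-- Store `v` in entry `i` of the array `a` of real numbers. -/
noncomputable def State.putRealArr (s : State) (a i : ℕ) (v : ℝ) : State :=
  { s with realArr := Function.update s.realArr a (Function.update (s.realArr a) i v) }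

/-- `Exec c s s' t`: the program `c`, started in the state `s`, halts in the state `s'` after
exactly `t` steps. Every evaluation of an operation and every store counts as one step. -/
inductive Exec : Program → State → State → ℕ → Prop
  | skip (s : State) : Exec .skip s s 1
  | setNat (x : ℕ) (e : NatExp) (s : State) :
      Exec (.setNat x e) s (s.putNat x (e.eval s)) (e.cost + 1)
  | setNatArr (a : ℕ) (i e : NatExp) (s : State) :
      Exec (.setNatArr a i e) s (s.putNatArr a (i.eval s) (e.eval s)) (i.cost + e.cost + 1)
  | setReal (x : ℕ) (e : RealExp) (s : State) :
      Exec (.setReal x e) s (s.putReal x (e.eval s)) (e.cost + 1)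
  | setRealArr (a : ℕ) (i : NatExp) (e : RealExp) (s : State) :
      Exec (.setRealArr a i e) s (s.putRealArr a (i.eval s) (e.eval s)) (i.cost + e.cost + 1)
  | seq {c d : Program} {s s' s'' : State} {t t' : ℕ} :
      Exec c s s' t → Exec d s' s'' t' → Exec (.seq c d) s s'' (t + t')
  | iteTrue {b : Test} {c d : Program} {s s' : State} {t : ℕ} :
      b.eval s → Exec c s s' t → Exec (.ite b c d) s s' (b.cost + t)
  | iteFalse {b : Test} {c d : Program} {s s' : State} {t : ℕ} :
      ¬ b.eval s → Exec d s s' t → Exec (.ite b c d) s s' (b.cost + t)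
  | loopDone {b : Test} {c : Program} {s : State} :
      ¬ b.eval s → Exec (.loop b c) s s b.cost
  | loopStep {b : Test} {c : Program} {s s' s'' : State} {t t' : ℕ} :
      b.eval s → Exec c s s' t → Exec (.loop b c) s' s'' t' →
        Exec (.loop b c) s s'' (b.cost + t + t')

end RealRAM

/-! ### Input of rooted geometric graphs -/

namespace Geom

variable {P : Finset Plane}

/-- A way of listing a geometric graph for input: the points are numbered `0, …, |P| - 1`, the
edges are numbered `0, …, |E| - 1`, both in any order, and edge `j` joins the points with numbers
`src j` and `tgt j` (in any order). -/
structure Listing (G : GeometricGraph P) where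
  vertex : Fin P.card ≃ P
  edge : Fin (numEdges G) ≃ G.edgeSet
  src : Fin (numEdges G) → Fin P.card
  tgt : Fin (numEdges G) → Fin P.card
  edge_eq : ∀ j, (edge j : Sym2 P) = s(vertex (src j), vertex (tgt j))

/-- The initial memory: natural number registers `0`, `1`, `2` hold `|P|`, `|E|` and the number of
the root; real arrays `0` and `1` hold the coordinates of the points; natural number arrays `0`
and `1` hold the numbers of the endpoints of the edges; everything else is zero. -/
noncomputable def Listing.initial {G : GeometricGraph P} (L : Listing G) (r : P) :
    RealRAM.State where
  natReg x := if x = 0 then P.card else if x = 1 then numEdges G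
    else if x = 2 then (L.vertex.symm r : ℕ) else 0
  natArr a j := if h : j < numEdges G then
      (if a = 0 then (L.src ⟨j, h⟩ : ℕ) else if a = 1 then (L.tgt ⟨j, h⟩ : ℕ) else 0)
    else 0
  realReg _ := 0
  realArr a i := if h : i < P.card then
      (if a = 0 then (L.vertex ⟨i, h⟩ : Plane) 0 else if a = 1 then (L.vertex ⟨i, h⟩ : Plane) 1
        else 0)
    else 0

end Geom

/-! Fix the axes. A monotone path from the root `r` to `p` stays in the box spanned by its ends, so
its last edge `qp` has `q` in that box. Conversely, if every `p ≠ r` has a neighbour `q` in the box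
spanned by `r` and `p`, then `q` is strictly closer to `r` in the ℓ¹ distance of the axes, and
appending `qp` to a monotone path to `q` gives one to `p`, by induction (`rootedXYMonotone_iff`).
The condition on paths thus becomes local: one good edge at every vertex.

Exchanging or reversing axes and scaling their directions changes nothing, so the directions may be
taken to be `(1 - t, t)` and `(-t, 1 - t)` with `0 ≤ t ≤ 1`; this needs no square roots
(`exists_param`, `exists_system`, `rootedUniform2DMonotone_iff`). For an oriented edge `qp` and a
choice of quadrant, the `t` for which `q - r` and `p - q` both lie in the closed quadrant are cut
out of `[0, 1]` by four affine inequalities. They form a closed interval, possibly empty, that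
belongs to `p` (`clip_spec`, `clipQuadrant_spec`). This yields `8|E|` intervals (`collect_runs`),
and it remains to decide whether some `t` lies, for every `p ≠ r`, in an interval of `p`.

A sweep passes the `16|E|` end points in increasing order, starts before ends at equal positions. It
counts the open intervals of each vertex and the vertices with a positive count; the answer is yes
exactly if this last number reaches `|P|`, the root being counted throughout (`SweepInv.step`,
`sweep_runs`). The next end point is the root of a tournament tree. Once passed, its key is raised
above all others and the path from its leaf is recomputed (`Tree.update_key`, `repair_runs`), which
costs `O(log |E|) = O(log |P|)`. -/

namespace RealRAM

/-! ### Reasoning about programs -/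

/-- The effect of a program without loops. -/
noncomputable def Program.run : Program → State → State
  | .skip, s => s
  | .setNat x e, s => s.putNat x (e.eval s)
  | .setNatArr a i e, s => s.putNatArr a (i.eval s) (e.eval s)
  | .setReal x e, s => s.putReal x (e.eval s)
  | .setRealArr a i e, s => s.putRealArr a (i.eval s) (e.eval s)
  | .seq c d, s => d.run (c.run s)
  | .ite b c d, s => open Classical in if b.eval s then c.run s else d.run s
  | .loop _ _, s => s

/-- The program has no loops. -/
def Program.loopFree : Program → Bool
  | .seq c d => c.loopFree && d.loopFree
  | .ite _ c d => c.loopFree && d.loopFree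
  | .loop _ _ => false
  | _ => true

/-- A bound for the number of steps of a program without loops. -/
def Program.bound : Program → ℕ
  | .skip => 1
  | .setNat _ e => e.cost + 1
  | .setNatArr _ i e => i.cost + e.cost + 1
  | .setReal _ e => e.cost + 1
  | .setRealArr _ i e => i.cost + e.cost + 1
  | .seq c d => c.bound + d.bound
  | .ite b c d => b.cost + (c.bound + d.bound)
  | .loop b _ => b.cost

/-- Started in `s`, the program `c` halts after at most `T` steps in a state satisfying `Q`. -/
def Runs (c : Program) (s : State) (T : ℕ) (Q : State → Prop) : Prop :=
  ∃ s' t, Exec c s s' t ∧ t ≤ T ∧ Q s'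

theorem Runs.mono {c : Program} {s : State} {T T' : ℕ} {Q Q' : State → Prop}
    (h : Runs c s T Q) (hT : T ≤ T') (hQ : ∀ s', Q s' → Q' s') : Runs c s T' Q' := by
  obtain ⟨s', t, h1, h2, h3⟩ := h
  exact ⟨s', t, h1, h2.trans hT, hQ _ h3⟩

theorem Runs.seq {c d : Program} {s : State} {T T' : ℕ} {Q Q' : State → Prop}
    (h : Runs c s T Q) (h' : ∀ s', Q s' → Runs d s' T' Q') :
    Runs (.seq c d) s (T + T') Q' := by
  obtain ⟨s', t, h1, h2, h3⟩ := h
  obtain ⟨s'', t', h4, h5, h6⟩ := h' s' h3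
  exact ⟨s'', t + t', .seq h1 h4, add_le_add h2 h5, h6⟩

/-- Loop-free code has a functional semantics, so its correctness reduces to computing `run` by
`simp`; the syntactic condition is settled by evaluation. -/
theorem Runs.of_run {c : Program} {s : State} {Q : State → Prop} (h : Q (c.run s))
    (hc : c.loopFree = true := by rfl) : Runs c s c.bound Q := by
  suffices H : ∀ s, ∃ t, Exec c s (c.run s) t ∧ t ≤ c.bound by
    obtain ⟨t, h1, h2⟩ := H s
    exact ⟨_, t, h1, h2, h⟩
  clear h
  induction c with
  | skip => exact fun s => ⟨_, .skip s, le_rfl⟩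
  | setNat x e => exact fun s => ⟨_, .setNat x e s, le_rfl⟩
  | setNatArr a i e => exact fun s => ⟨_, .setNatArr a i e s, le_rfl⟩
  | setReal x e => exact fun s => ⟨_, .setReal x e s, le_rfl⟩
  | setRealArr a i e => exact fun s => ⟨_, .setRealArr a i e s, le_rfl⟩
  | seq c d ihc ihd =>
    rw [Program.loopFree, Bool.and_eq_true] at hc
    intro s
    obtain ⟨t, h1, h2⟩ := ihc hc.1 s
    obtain ⟨t', h3, h4⟩ := ihd hc.2 (c.run s)
    exact ⟨_, .seq h1 h3, add_le_add h2 h4⟩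
  | ite b c d ihc ihd =>
    rw [Program.loopFree, Bool.and_eq_true] at hc
    intro s
    by_cases hb : b.eval s
    · obtain ⟨t, h1, h2⟩ := ihc hc.1 s
      refine ⟨b.cost + t, ?_, by simp only [Program.bound]; omega⟩
      rw [Program.run, if_pos hb]
      exact .iteTrue hb h1
    · obtain ⟨t, h1, h2⟩ := ihd hc.2 s
      refine ⟨b.cost + t, ?_, by simp only [Program.bound]; omega⟩
      rw [Program.run, if_neg hb]
      exact .iteFalse hb h1
  | loop b c => simp [Program.loopFree] at hc

/-- The rule for loops: `I n` is an invariant for the situation that at most `n` passes through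
the body remain. -/
theorem Runs.loop {b : Test} {c : Program} {T : ℕ} (I : ℕ → State → Prop)
    (hI : ∀ n s, I n s → b.eval s → ∃ n', n = n' + 1 ∧ Runs c s T (I n')) {n : ℕ} {s : State}
    (hs : I n s) :
    Runs (.loop b c) s (n * (T + b.cost) + b.cost) (fun s' => (∃ n', I n' s') ∧ ¬ b.eval s') := by
  induction n generalizing s with
  | zero =>
    have hb : ¬ b.eval s := fun hb => by
      obtain ⟨n', h, -⟩ := hI 0 s hs hb
      omega
    exact ⟨s, _, .loopDone hb, by omega, ⟨0, hs⟩, hb⟩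
  | succ n ih =>
    by_cases hb : b.eval s
    · obtain ⟨n', h, s', t, h1, h2, h3⟩ := hI _ s hs hb
      obtain rfl : n = n' := by omega
      obtain ⟨s'', t', h4, h5, h6⟩ := ih h3
      refine ⟨s'', _, .loopStep hb h1 h4, ?_, h6⟩
      rw [Nat.succ_mul]
      omega
    · exact ⟨s, _, .loopDone hb, by omega, ⟨_, hs⟩, hb⟩

/-! ### Reading the memory after a store. -/

section simpLemmas

variable (s : State) (x i v : ℕ) (w : ℝ)

@[simp] theorem State.putNat_natReg (y : ℕ) :
    (s.putNat x v).natReg y = if y = x then v else s.natReg y := by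
  simp [State.putNat, Function.update_apply]
@[simp] theorem State.putNat_natArr : (s.putNat x v).natArr = s.natArr := rfl
@[simp] theorem State.putNat_realReg : (s.putNat x v).realReg = s.realReg := rfl
@[simp] theorem State.putNat_realArr : (s.putNat x v).realArr = s.realArr := rfl
@[simp] theorem State.putNatArr_natReg : (s.putNatArr x i v).natReg = s.natReg := rfl
@[simp] theorem State.putNatArr_natArr (y : ℕ) : (s.putNatArr x i v).natArr y =
    if y = x then Function.update (s.natArr x) i v else s.natArr y := by
  simp only [State.putNatArr, Function.update_apply]
@[simp] theorem State.putNatArr_realReg : (s.putNatArr x i v).realReg = s.realReg := rfl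
@[simp] theorem State.putNatArr_realArr : (s.putNatArr x i v).realArr = s.realArr := rfl
@[simp] theorem State.putReal_natReg : (s.putReal x w).natReg = s.natReg := rfl
@[simp] theorem State.putReal_natArr : (s.putReal x w).natArr = s.natArr := rfl
@[simp] theorem State.putReal_realReg (y : ℕ) :
    (s.putReal x w).realReg y = if y = x then w else s.realReg y := by
  simp [State.putReal, Function.update_apply]
@[simp] theorem State.putReal_realArr : (s.putReal x w).realArr = s.realArr := rfl
@[simp] theorem State.putRealArr_natReg : (s.putRealArr x i w).natReg = s.natReg := rfl
@[simp] theorem State.putRealArr_natArr : (s.putRealArr x i w).natArr = s.natArr := rfl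
@[simp] theorem State.putRealArr_realReg : (s.putRealArr x i w).realReg = s.realReg := rfl
@[simp] theorem State.putRealArr_realArr (y : ℕ) : (s.putRealArr x i w).realArr y =
    if y = x then Function.update (s.realArr x) i w else s.realArr y := by
  simp only [State.putRealArr, Function.update_apply]

end simpLemmas

/-! ### Tournament trees -/

/-- The lexicographic order of the items `x` and `y` by key and number. -/
def KeyLE (K : ℕ → ℝ) (x y : ℕ) : Prop := K x < K y ∨ K x = K y ∧ x ≤ y

theorem KeyLE.refl (K : ℕ → ℝ) (x : ℕ) : KeyLE K x x := Or.inr ⟨rfl, le_rfl⟩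

theorem KeyLE.trans {K : ℕ → ℝ} {x y z : ℕ} (h : KeyLE K x y) (h' : KeyLE K y z) :
    KeyLE K x z := by
  rcases h with h | ⟨h, h1⟩ <;> rcases h' with h' | ⟨h', h1'⟩
  · exact .inl (h.trans h')
  · exact .inl (h.trans_eq h')
  · exact .inl (h.trans_lt h')
  · exact .inr ⟨h.trans h', h1.trans h1'⟩

/-- Node `k` of the tournament tree holds the winner of its two children. -/
def NodeOK (K : ℕ → ℝ) (win : ℕ → ℕ) (k : ℕ) : Prop :=
  (win k = win (2 * k) ∨ win k = win (2 * k + 1)) ∧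
    KeyLE K (win k) (win (2 * k)) ∧ KeyLE K (win k) (win (2 * k + 1))

/-- `win` is a tournament tree with `N` leaves, except that only the nodes from `i` on are
considered, and that the inner nodes with `exc` need not hold the correct winner. Leaf `N + j`
holds item `j`. -/
structure Tree (N : ℕ) (K : ℕ → ℝ) (win : ℕ → ℕ) (i : ℕ) (exc : ℕ → Prop) : Prop where
  leaf : ∀ j < N, win (N + j) = j
  desc : ∀ k, i ≤ k → 1 ≤ k → k < 2 * N → win k < N ∧ ∃ m, (N + win k) / 2 ^ m = k
  node : ∀ k, i ≤ k → 1 ≤ k → k < N → NodeOK K win k ∨ exc k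

/-- Each node beats its children, so by transitivity, going down from node `1`, the root's item
beats every node and in particular every leaf. -/
theorem Tree.root_le {N : ℕ} {K : ℕ → ℝ} {win : ℕ → ℕ}
    (h : Tree N K win 1 (fun _ => False)) {j : ℕ} (hj : j < N) : KeyLE K (win 1) j := by
  have H : ∀ k, 1 ≤ k → k < 2 * N → KeyLE K (win 1) (win k) := by
    intro k
    induction k using Nat.strong_induction_on with
    | _ k ih =>
      intro h1 h2
      rcases h1.eq_or_lt with rfl | h1
      · exact .refl _ _
      · have h3 := ih (k / 2) (by omega) (by omega) (by omega)
        obtain h4 | h4 := h.node (k / 2) (by omega) (by omega) (by omega)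
        · rcases Nat.even_or_odd' k with ⟨c, hc | hc⟩
          · have : k / 2 = c := by omega
            rw [this] at h3 h4
            rw [hc]
            exact h3.trans h4.2.1
          · have : k / 2 = c := by omega
            rw [this] at h3 h4
            rw [hc]
            exact h3.trans h4.2.2
        · exact h4.elim
  have := H (N + j) (by omega) (by omega)
  rwa [h.leaf j hj] at this

/-- Changing node `k` can spoil only its parent. Either the parent is listed as an exception
(repair, where `i = 1`) or it lies before the range considered (construction, where `i = k + 1`);
`min i k` serves both uses. -/
theorem Tree.recompute {N : ℕ} {K : ℕ → ℝ} {win : ℕ → ℕ} {i : ℕ} {exc exc' : ℕ → Prop} {k w : ℕ}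
    (h : Tree N K win i exc) (hk : 1 ≤ k) (hkN : k < N) (hik : i ≤ k + 1)
    (hw : w = win (2 * k) ∨ w = win (2 * k + 1))
    (hw1 : KeyLE K w (win (2 * k))) (hw2 : KeyLE K w (win (2 * k + 1)))
    (hexc : ∀ l, exc l → l ≠ k → exc' l) (hexc' : exc' (k / 2) ∨ k / 2 < min i k) :
    Tree N K (Function.update win k w) (min i k) exc' := by
  have up : ∀ l, l ≠ k → Function.update win k w l = win l :=
    fun l hl => Function.update_of_ne hl _ _
  have d1 := h.desc (2 * k) (by omega) (by omega) (by omega)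
  have d2 := h.desc (2 * k + 1) (by omega) (by omega) (by omega)
  refine ⟨fun j hj => by rw [up _ (by omega)]; exact h.leaf j hj, fun l hl h1 h2 => ?_,
    fun l hl h1 h2 => ?_⟩
  · by_cases hlk : l = k
    · subst hlk
      rw [Function.update_self]
      rcases hw with rfl | rfl
      · obtain ⟨h3, m, h4⟩ := d1
        exact ⟨h3, m + 1, by rw [pow_succ, ← Nat.div_div_eq_div_mul, h4]; omega⟩
      · obtain ⟨h3, m, h4⟩ := d2
        exact ⟨h3, m + 1, by rw [pow_succ, ← Nat.div_div_eq_div_mul, h4]; omega⟩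
    · rw [up l hlk]
      exact h.desc l (by omega) h1 h2
  · by_cases hlk : l = k
    · subst hlk
      refine .inl ?_
      unfold NodeOK
      rw [Function.update_self, up _ (by omega), up _ (by omega)]
      exact ⟨hw, hw1, hw2⟩
    · by_cases hlk' : l = k / 2
      · subst hlk'
        rcases hexc' with h' | h'
        · exact .inr h'
        · omega
      · rcases h.node l (by omega) h1 h2 with h3 | h3
        · refine .inl ?_
          unfold NodeOK
          rw [up _ hlk, up _ (by omega), up _ (by omega)]
          exact h3
        · exact .inr (hexc l h3 hlk)

/-- If the key of an item grows, then only the ancestors of its leaf may become wrong. -/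
theorem Tree.update_key {N : ℕ} {K : ℕ → ℝ} {win : ℕ → ℕ}
    (h : Tree N K win 1 (fun _ => False)) (l : ℕ) {a : ℝ} (ha : K l ≤ a) :
    Tree N (Function.update K l a) win 1 (fun k => ∃ m, (N + l) / 2 ^ (m + 1) = k) := by
  refine ⟨h.leaf, h.desc, fun k h1 h2 h3 => ?_⟩
  -- By `desc`, a node won by `l` is an ancestor of leaf `N + l`. At every other node the winner
  -- keeps its key while the keys of its rivals do not decrease, so it still wins.
  by_cases hk : win k = l
  · obtain ⟨-, m, h5⟩ := h.desc k h1 h2 (by omega)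
    rw [hk] at h5
    refine .inr ⟨m - 1, ?_⟩
    -- For `m = 0` the node would be the leaf itself, which is excluded by `k < N`.
    rcases m with _ | m
    · simp at h5
      omega
    · simpa using h5
  · obtain ⟨h4, h5, h6⟩ := (h.node k h1 h2 h3).resolve_right id
    have H : ∀ y, KeyLE K (win k) y → KeyLE (Function.update K l a) (win k) y := by
      intro y hy
      unfold KeyLE at *
      rw [Function.update_of_ne hk]
      by_cases hyl : y = l
      · subst hyl
        rw [Function.update_self]
        rcases hy with hy | ⟨hy, hy'⟩
        · exact .inl (hy.trans_le ha)
        · rcases ha.lt_or_eq with ha | ha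
          · exact .inl (hy.trans_lt ha)
          · exact .inr ⟨hy.trans ha, hy'⟩
      · rw [Function.update_of_ne hyl]
        exact hy
    exact .inl ⟨h4, H _ h5, H _ h6⟩

end RealRAM

namespace RealRAM

/-! ### Building and repairing tournament trees -/

/-- The memory is unchanged except for the given registers and arrays. -/
structure Frame (X A : List ℕ) (s s' : State) : Prop where
  natReg : ∀ x, x ∉ X → s'.natReg x = s.natReg x
  natArr : ∀ a, a ∉ A → s'.natArr a = s.natArr a
  realArr : s'.realArr = s.realArr

theorem Frame.refl (X A : List ℕ) (s : State) : Frame X A s s :=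
  ⟨fun _ _ => rfl, fun _ _ => rfl, rfl⟩

theorem Frame.trans {X A : List ℕ} {s s' s'' : State} (h : Frame X A s s')
    (h' : Frame X A s' s'') : Frame X A s s'' :=
  ⟨fun x hx => (h'.natReg x hx).trans (h.natReg x hx),
    fun a ha => (h'.natArr a ha).trans (h.natArr a ha), h'.realArr.trans h.realArr⟩

theorem Frame.mono {X A X' A' : List ℕ} {s s' : State} (h : Frame X A s s')
    (hX : X ⊆ X') (hA : A ⊆ A') : Frame X' A' s s' :=
  ⟨fun x hx => h.natReg x fun h' => hx (hX h'), fun a ha => h.natArr a fun h' => ha (hA h'),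
    h.realArr⟩

/-- Let node `i` of the tree hold the winner of its children. -/
def recompute : Program :=
  .seq (.setNat 10 (.arr 3 (.add (.reg 9) (.reg 9))))
    (.seq (.setNat 11 (.arr 3 (.add (.add (.reg 9) (.reg 9)) (.const 1))))
      (.ite (.or (.realLt (.arr 2 (.reg 11)) (.arr 2 (.reg 10)))
          (.and (.realEq (.arr 2 (.reg 11)) (.arr 2 (.reg 10))) (.natLt (.reg 11) (.reg 10))))
        (.setNatArr 3 (.reg 9) (.reg 11)) (.setNatArr 3 (.reg 9) (.reg 10))))

theorem recompute_spec (s : State) :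
    ∃ w, (w = s.natArr 3 (2 * s.natReg 9) ∨ w = s.natArr 3 (2 * s.natReg 9 + 1)) ∧
      KeyLE (s.realArr 2) w (s.natArr 3 (2 * s.natReg 9)) ∧
      KeyLE (s.realArr 2) w (s.natArr 3 (2 * s.natReg 9 + 1)) ∧
      (recompute.run s).natArr 3 = Function.update (s.natArr 3) (s.natReg 9) w ∧
      Frame [10, 11] [3] s (recompute.run s) := by
  set x := s.natArr 3 (2 * s.natReg 9) with hx
  set y := s.natArr 3 (2 * s.natReg 9 + 1) with hy
  have e : s.natReg 9 + s.natReg 9 = 2 * s.natReg 9 := by ring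
  by_cases h : s.realArr 2 y < s.realArr 2 x ∨ s.realArr 2 y = s.realArr 2 x ∧ y < x
  · refine ⟨y, .inr rfl, ?_, .refl _ _, ?_, ?_⟩
    · exact h.imp id (fun h => ⟨h.1, h.2.le⟩)
    · simp [recompute, Program.run, Test.eval, RealExp.eval, NatExp.eval, e, ← hx, ← hy, h]
    · constructor <;>
        simp +contextual [recompute, Program.run, Test.eval, RealExp.eval, NatExp.eval, e,
          ← hx, ← hy, h]
  · refine ⟨x, .inl rfl, .refl _ _, ?_, ?_, ?_⟩
    · rw [not_or, not_and, not_lt, not_lt] at h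
      exact h.1.lt_or_eq.imp id fun h' => ⟨h', h.2 h'.symm⟩
    · simp [recompute, Program.run, Test.eval, RealExp.eval, NatExp.eval, e, ← hx, ← hy, h]
    · constructor <;>
        simp +contextual [recompute, Program.run, Test.eval, RealExp.eval, NatExp.eval, e,
          ← hx, ← hy, h]

/-- Move from node `i` to its parent and recompute it. -/
def repairStep : Program := .seq (.setNat 9 (.arr 4 (.reg 9))) recompute

/-- Recompute all proper ancestors of node `i`. -/
def repair : Program := .loop (.natLt (.const 1) (.reg 9)) repairStep

/-- The possibly wrong nodes are always the proper ancestors of the current node; passing to the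
parent removes one of them. Parents are looked up in array `4`, since the machine cannot halve, and
`n` bounds the number of levels. -/
theorem repair_runs {N n : ℕ} {s : State}
    (htree : Tree N (s.realArr 2) (s.natArr 3) 1 (fun k => ∃ m, s.natReg 9 / 2 ^ (m + 1) = k))
    (hN : s.natReg 9 < 2 * N) (hpar : ∀ i, 2 ≤ i → i < 2 * N → s.natArr 4 i = i / 2)
    (hn : s.natReg 9 < 2 ^ (n + 1)) :
    Runs repair s (n * (repairStep.bound + 3) + 3) (fun s' =>
      Tree N (s'.realArr 2) (s'.natArr 3) 1 (fun _ => False) ∧ Frame [9, 10, 11] [3] s s') := by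
  refine (Runs.loop (fun n s' =>
    Tree N (s'.realArr 2) (s'.natArr 3) 1 (fun k => ∃ m, s'.natReg 9 / 2 ^ (m + 1) = k) ∧
    s'.natReg 9 < 2 * N ∧ s'.natReg 9 < 2 ^ (n + 1) ∧ Frame [9, 10, 11] [3] s s') ?_
    ⟨htree, hN, hn, .refl _ _ _⟩).mono le_rfl ?_
  · rintro n s' ⟨h1, h2, h3, h4⟩ h5
    have hi : 1 < s'.natReg 9 := h5
    obtain ⟨n, rfl⟩ : ∃ n', n = n' + 1 := ⟨n - 1, by
      rcases n with _ | n
      · simp at h3; omega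
      · omega⟩
    refine ⟨n, rfl, Runs.of_run (c := repairStep) ?_⟩
    have hp : s'.natArr 4 (s'.natReg 9) = s'.natReg 9 / 2 := by
      rw [h4.natArr 4 (by decide)]
      exact hpar _ (by omega) h2
    set u := (Program.setNat 9 (.arr 4 (.reg 9))).run s' with hu
    have hu9 : u.natReg 9 = s'.natReg 9 / 2 := by
      simp [hu, Program.run, NatExp.eval, hp]
    have hu3 : u.natArr = s'.natArr := by simp [hu, Program.run]
    have huK : u.realArr = s'.realArr := by simp [hu, Program.run]
    have huF : Frame [9, 10, 11] [3] s' u := by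
      constructor <;> simp +contextual [hu, Program.run]
    obtain ⟨w, w1, w2, w3, w4, w5⟩ := recompute_spec u
    have w6 : (recompute.run u).natReg 9 = s'.natReg 9 / 2 := by
      rw [w5.natReg 9 (by decide), hu9]
    simp only [hu9, hu3, huK] at w1 w2 w3 w4
    change Tree N ((recompute.run u).realArr 2) ((recompute.run u).natArr 3) 1
      (fun k => ∃ m, (recompute.run u).natReg 9 / 2 ^ (m + 1) = k) ∧
      (recompute.run u).natReg 9 < 2 * N ∧ (recompute.run u).natReg 9 < 2 ^ (n + 1) ∧
      Frame [9, 10, 11] [3] s (recompute.run u)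
    rw [w6, w4, w5.realArr, huK]
    refine ⟨?_, by omega, by rw [pow_succ] at h3; omega,
      h4.trans (huF.trans (w5.mono (by simp) (by simp)))⟩
    have := h1.recompute (k := s'.natReg 9 / 2)
      (exc' := fun k => ∃ m, s'.natReg 9 / 2 / 2 ^ (m + 1) = k)
      (by omega) (by omega) (by omega) w1 w2 w3 ?_ (.inl ⟨0, by simp⟩)
    · rwa [min_eq_left (by omega)] at this
    · rintro l ⟨m, hm⟩ hl
      rcases m with _ | m
      · simp at hm
        omega
      · refine ⟨m, ?_⟩
        rw [← hm, pow_succ' 2 (m + 1), Nat.div_div_eq_div_mul]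
  · rintro s' ⟨⟨n', h1, h2, h3, h4⟩, h5⟩
    -- At a node with index at most `1` the only proper ancestor is the fictitious node `0`.
    refine ⟨⟨h1.leaf, h1.desc, fun k hk1 hk2 hk3 => (h1.node k hk1 hk2 hk3).imp id ?_⟩, h4⟩
    rintro ⟨m, hm⟩
    have h6 : ¬ 1 < s'.natReg 9 := h5
    have : s'.natReg 9 < 2 ^ (m + 1) := by
      have := Nat.one_lt_two_pow (n := m + 1) (by omega)
      omega
    rw [Nat.div_eq_of_lt this] at hm
    omega

/-- Store the items in the leaves. -/
def fillStep : Program :=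
  .seq (.setNatArr 3 (.add (.reg 8) (.reg 9)) (.reg 9)) (.setNat 9 (.add (.reg 9) (.const 1)))

/-- Compute the node before `i`, and store the parent of its children. -/
def buildStep : Program :=
  .seq (.setNat 9 (.sub (.reg 9) (.const 1)))
    (.seq recompute
      (.seq (.setNatArr 4 (.add (.reg 9) (.reg 9)) (.reg 9))
        (.setNatArr 4 (.add (.add (.reg 9) (.reg 9)) (.const 1)) (.reg 9))))

/-- Build the tournament tree of all items. -/
def build : Program :=
  .seq (.setNat 9 (.const 0))
    (.seq (.loop (.natLt (.reg 9) (.reg 8)) fillStep)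
      (.seq (.setNat 9 (.reg 8)) (.loop (.natLt (.const 1) (.reg 9)) buildStep)))

/-- Nodes are computed from `N - 1` down to `1`, so both children are ready when a node is reached.
The same pass tabulates the parents, giving linear time without any division. -/
theorem build_runs {s : State} {N : ℕ} (hN : s.natReg 8 = N) :
    Runs build s (N * (fillStep.bound + buildStep.bound + 6) + 10) (fun s' =>
      Tree N (s'.realArr 2) (s'.natArr 3) 1 (fun _ => False) ∧
      (∀ i, 2 ≤ i → i < 2 * N → s'.natArr 4 i = i / 2) ∧ Frame [9, 10, 11] [3, 4] s s') := by
  have hfill : Runs (.seq (.setNat 9 (.const 0)) (.loop (.natLt (.reg 9) (.reg 8)) fillStep)) s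
      (2 + (N * (fillStep.bound + 3) + 3)) (fun s' =>
        (∀ j < N, s'.natArr 3 (N + j) = j) ∧ Frame [9, 10, 11] [3, 4] s s') := by
    refine Runs.seq (Runs.of_run (c := .setNat 9 (.const 0)) (Q := (· = _)) rfl) ?_
    rintro _ rfl
    refine (Runs.loop (fun n s' => s'.natReg 9 + n = N ∧
      (∀ j < s'.natReg 9, s'.natArr 3 (N + j) = j) ∧ Frame [9, 10, 11] [3, 4] s s') ?_
      (n := N) ?_).mono le_rfl ?_
    · rintro n s' ⟨h1, h2, h3⟩ h4
      have h8 : s'.natReg 8 = N := (h3.natReg 8 (by decide)).trans hN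
      have h4 : s'.natReg 9 < s'.natReg 8 := h4
      obtain ⟨n, rfl⟩ : ∃ n', n = n' + 1 := ⟨n - 1, by omega⟩
      refine ⟨n, rfl, Runs.of_run (c := fillStep) ⟨?_, ?_, h3.trans ?_⟩⟩
      · simp [fillStep, Program.run, NatExp.eval]
        omega
      · simp only [fillStep, Program.run, NatExp.eval, State.putNat_natReg, if_true,
          State.putNatArr_natReg, State.putNat_natArr, State.putNatArr_natArr, h8]
        intro j hj
        rcases (Nat.lt_succ_iff.mp hj).lt_or_eq with hj | rfl
        · rw [Function.update_of_ne (by omega)]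
          exact h2 j hj
        · rw [Function.update_self]
      · constructor <;> simp +contextual [fillStep, Program.run, NatExp.eval]
    · refine ⟨by simp [Program.run, NatExp.eval], by simp [Program.run, NatExp.eval], ?_⟩
      constructor <;> simp +contextual [Program.run, NatExp.eval]
    · rintro s' ⟨⟨n, h1, h2, h3⟩, h4⟩
      have h8 : s'.natReg 8 = N := (h3.natReg 8 (by decide)).trans hN
      have h4 : ¬ s'.natReg 9 < s'.natReg 8 := h4
      exact ⟨fun j hj => h2 j (by omega), h3⟩
  obtain ⟨u, t, hx, ht, hu, hF⟩ := hfill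
  have hbuild : Runs (.seq (.setNat 9 (.reg 8)) (.loop (.natLt (.const 1) (.reg 9)) buildStep)) u
      (2 + (N * (buildStep.bound + 3) + 3)) (fun s' =>
        Tree N (s'.realArr 2) (s'.natArr 3) 1 (fun _ => False) ∧
      (∀ i, 2 ≤ i → i < 2 * N → s'.natArr 4 i = i / 2) ∧ Frame [9, 10, 11] [3, 4] u s') := by
    have hu8 : u.natReg 8 = N := (hF.natReg 8 (by decide)).trans hN
    refine Runs.seq (Runs.of_run (c := .setNat 9 (.reg 8)) (Q := (· = _)) rfl) ?_
    rintro _ rfl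
    refine (Runs.loop (fun n s' => s'.natReg 9 ≤ n ∧ s'.natReg 9 ≤ N ∧
      (1 ≤ N → 1 ≤ s'.natReg 9) ∧
      Tree N (s'.realArr 2) (s'.natArr 3) (s'.natReg 9) (fun _ => False) ∧
      (∀ i, 2 * s'.natReg 9 ≤ i → i < 2 * N → s'.natArr 4 i = i / 2) ∧
      Frame [9, 10, 11] [3, 4] u s') ?_ (n := N) ?_).mono le_rfl ?_
    · rintro n s' ⟨h1, h2, h2', h3, h4, h5⟩ h6
      have h6 : 1 < s'.natReg 9 := h6
      obtain ⟨n, rfl⟩ : ∃ n', n = n' + 1 := ⟨n - 1, by omega⟩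
      refine ⟨n, rfl, Runs.of_run (c := buildStep) ?_⟩
      obtain ⟨i, hi⟩ : ∃ i, s'.natReg 9 = i + 1 := ⟨s'.natReg 9 - 1, by omega⟩
      set v := (Program.setNat 9 (.sub (.reg 9) (.const 1))).run s' with hv
      have hv9 : v.natReg 9 = i := by simp [hv, Program.run, NatExp.eval, hi]
      have hv3 : v.natArr = s'.natArr := by simp [hv, Program.run]
      have hvK : v.realArr = s'.realArr := by simp [hv, Program.run]
      have hvF : Frame [9, 10, 11] [3, 4] s' v := by
        constructor <;> simp +contextual [hv, Program.run]
      obtain ⟨w, w1, w2, w3, w4, w5⟩ := recompute_spec v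
      have w6 : (recompute.run v).natReg 9 = i := by rw [w5.natReg 9 (by decide), hv9]
      simp only [hv9, hv3, hvK] at w1 w2 w3 w4
      rw [hi] at h1 h2 h3 h4
      have key : buildStep.run s' = ((recompute.run v).putNatArr 4 (i + i) i).putNatArr 4
          (i + i + 1) i := by
        simp only [hv, Program.run, NatExp.eval] at w6
        simp [buildStep, Program.run, NatExp.eval, w6, hv]
      have w7 : (recompute.run v).natArr 4 = s'.natArr 4 := by
        rw [w5.natArr 4 (by decide), hv3]
      have hreg : (buildStep.run s').natReg 9 = i := by rw [key]; simp [w6]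
      have harr3 : (buildStep.run s').natArr 3 = Function.update (s'.natArr 3) i w := by
        rw [key]; simp [w4]
      have harr4 : (buildStep.run s').natArr 4 = Function.update (Function.update (s'.natArr 4)
          (i + i) i) (i + i + 1) i := by
        rw [key]; simp [w7]
      rw [hreg, harr3, harr4]
      have hK : (buildStep.run s').realArr = s'.realArr := by
        rw [key]; simp [w5.realArr, hvK]
      rw [hK]
      refine ⟨by omega, by omega, by omega, ?_, ?_, ?_⟩
      · have := h3.recompute (k := i) (exc' := fun _ => False) (by omega) (by omega) (by omega)
          w1 w2 w3 (fun l hl _ => hl) (.inr (by omega))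
        rwa [min_eq_right (by omega)] at this
      · intro j hj1 hj2
        by_cases hj : j = i + i + 1
        · subst hj
          rw [Function.update_self]
          omega
        · rw [Function.update_of_ne hj]
          by_cases hj' : j = i + i
          · subst hj'
            rw [Function.update_self]
            omega
          · rw [Function.update_of_ne hj']
            exact h4 j (by omega) hj2
      · refine h5.trans (hvF.trans (Frame.trans (w5.mono (by simp) (by simp)) ?_))
        rw [key]
        constructor <;> simp +contextual
    · have e9 : ((Program.setNat 9 (.reg 8)).run u).natReg 9 = N := by
        simp [Program.run, NatExp.eval, hu8]
      have e3 : ((Program.setNat 9 (.reg 8)).run u).natArr = u.natArr := rfl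
      simp only [e9, e3]
      refine ⟨le_rfl, le_rfl, id, ⟨hu, fun k h1 h2 h3 => ?_, fun k h1 h2 h3 => ?_⟩,
        fun i h1 h2 => by omega, ?_⟩
      · have := hu (k - N) (by omega)
        rw [Nat.add_sub_cancel' h1] at this
        rw [this]
        exact ⟨by omega, 0, by simp; omega⟩
      · omega
      · constructor <;> simp +contextual [Program.run, NatExp.eval]
    · rintro s' ⟨⟨n, h1, h2, h2', h3, h4, h5⟩, h6⟩
      have h6 : ¬ 1 < s'.natReg 9 := h6
      refine ⟨⟨h3.leaf, fun k => ?_, fun k => ?_⟩, fun i hi => h4 i (by omega), h5⟩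
      · intro hk _ hk'
        exact h3.desc k (by omega) hk hk'
      · intro hk _ hk'
        exact h3.node k (by omega) hk hk'
  obtain ⟨u', t', hx', ht', h1, h2, h3⟩ := hbuild
  -- The filling phase was treated as one program, while `build` associates to the right; its
  -- execution is taken apart and reassembled.
  rcases hx with _ | _ | _ | _ | _ | @⟨_, _, _, _, _, t1, t2, hx1, hx2⟩
  refine ⟨u', t1 + (t2 + t'), .seq hx1 (.seq hx2 hx'), ?_, h1, h2, hF.trans h3⟩
  have : N * (fillStep.bound + buildStep.bound + 6) =
    N * (fillStep.bound + 3) + N * (buildStep.bound + 3) := by ring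
  omega

end RealRAM

namespace RealRAM

/-! ### The sweep -/

/-- Among the `p` first counters, the number of positive ones. -/
def posCount (p : ℕ) (c : ℕ → ℕ) : ℕ := ((Finset.range p).filter fun v => 0 < c v).card

theorem posCount_update_pos {p v a : ℕ} {c : ℕ → ℕ} (hv : v < p) (h0 : c v = 0) (ha : 0 < a) :
    posCount p (Function.update c v a) = posCount p c + 1 := by
  unfold posCount
  have : (Finset.range p).filter (fun w => 0 < Function.update c v a w) =
      insert v ((Finset.range p).filter fun w => 0 < c w) := by
    ext w
    by_cases hw : w = v
    · subst hw; simp [hv, ha]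
    · simp [hw]
  rw [this, Finset.card_insert_of_notMem (by simp [h0])]

/-- Restoring the old positive value is an instance of the previous lemma, read backwards. -/
theorem posCount_update_zero {p v : ℕ} {c : ℕ → ℕ} (hv : v < p) (h0 : 0 < c v) :
    posCount p (Function.update c v 0) = posCount p c - 1 := by
  have := posCount_update_pos (c := Function.update c v 0) hv (by simp) h0
  simp only [Function.update_idem, Function.update_eq_self] at this
  omega

theorem posCount_update_same {p v a : ℕ} {c : ℕ → ℕ} (h0 : 0 < c v) (ha : 0 < a) :
    posCount p (Function.update c v a) = posCount p c := by
  unfold posCount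
  congr 1
  ext w
  by_cases hw : w = v
  · subst hw; simp [ha, h0]
  · simp [hw]

/-- Adapt the counters when item `l` is passed: it is the start (`l < M`) or the end of an interval
that belongs to `v`. -/
def account : Program :=
  .ite (.natLt (.reg 15) (.reg 5))
    (.seq (.ite (.natEq (.arr 5 (.reg 6)) (.const 0)) (.setNat 13 (.add (.reg 13) (.const 1)))
      .skip) (.setNatArr 5 (.reg 6) (.add (.arr 5 (.reg 6)) (.const 1))))
    (.seq (.setNatArr 5 (.reg 6) (.sub (.arr 5 (.reg 6)) (.const 1)))
      (.ite (.natEq (.arr 5 (.reg 6)) (.const 0)) (.setNat 13 (.sub (.reg 13) (.const 1))) .skip))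

/-- The number of positive counters changes only when a counter leaves or reaches `0`. Positivity at
an end point makes the truncated subtraction exact. -/
theorem account_spec {p v : ℕ} {s : State} (h13 : s.natReg 13 = posCount p (s.natArr 5))
    (h6 : s.natReg 6 = v) (hv : v < p) (hpos : s.natReg 5 ≤ s.natReg 15 → 0 < s.natArr 5 v) :
    (account.run s).natArr 5 = Function.update (s.natArr 5) v
      (if s.natReg 15 < s.natReg 5 then s.natArr 5 v + 1 else s.natArr 5 v - 1) ∧
    (account.run s).natReg 13 = posCount p ((account.run s).natArr 5) ∧
    Frame [13] [5] s (account.run s) := by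
  by_cases h : s.natReg 15 < s.natReg 5
  · by_cases h0 : s.natArr 5 v = 0
    · have e : (account.run s).natArr 5 = Function.update (s.natArr 5) v (s.natArr 5 v + 1) := by
        simp [account, Program.run, Test.eval, NatExp.eval, h, h6, h0]
      refine ⟨by rw [e, if_pos h], ?_, ?_⟩
      · rw [e, posCount_update_pos hv h0 (by omega), ← h13]
        simp [account, Program.run, Test.eval, NatExp.eval, h, h6, h0]
      · constructor <;>
          simp +contextual [account, Program.run, Test.eval, NatExp.eval, h, h6, h0]
    · have e : (account.run s).natArr 5 = Function.update (s.natArr 5) v (s.natArr 5 v + 1) := by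
        simp [account, Program.run, Test.eval, NatExp.eval, h, h6, h0]
      refine ⟨by rw [e, if_pos h], ?_, ?_⟩
      · rw [e, posCount_update_same (by omega) (by omega), ← h13]
        simp [account, Program.run, Test.eval, NatExp.eval, h, h6, h0]
      · constructor <;>
          simp +contextual [account, Program.run, Test.eval, NatExp.eval, h, h6, h0]
  · have hp := hpos (by omega)
    by_cases h0 : s.natArr 5 v - 1 = 0
    · have e : (account.run s).natArr 5 = Function.update (s.natArr 5) v (s.natArr 5 v - 1) := by
        simp [account, Program.run, Test.eval, NatExp.eval, h, h6, h0]
      refine ⟨by rw [e, if_neg h], ?_, ?_⟩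
      · rw [e, h0, posCount_update_zero hv hp, ← h13]
        simp [account, Program.run, Test.eval, NatExp.eval, h, h6, h0]
      · constructor <;>
          simp +contextual [account, Program.run, Test.eval, NatExp.eval, h, h6, h0]
    · have e : (account.run s).natArr 5 = Function.update (s.natArr 5) v (s.natArr 5 v - 1) := by
        simp [account, Program.run, Test.eval, NatExp.eval, h, h6, h0]
      refine ⟨by rw [e, if_neg h], ?_, ?_⟩
      · rw [e, posCount_update_same hp (by omega), ← h13]
        simp [account, Program.run, Test.eval, NatExp.eval, h, h6, h0]
      · constructor <;>
          simp +contextual [account, Program.run, Test.eval, NatExp.eval, h, h6, h0]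

/-! ### Intervals, coverage and counts of open intervals. -/

/-- Interval `i < M` is `[K i, K (M + i)]`, it lies in `[0, 1]` and belongs to `V i < p`. -/
structure Intervals (p M : ℕ) (V : ℕ → ℕ) (K : ℕ → ℝ) : Prop where
  lt : ∀ i < M, V i < p
  eq : ∀ i < M, V (M + i) = V i
  nonneg : ∀ i < M, 0 ≤ K i
  le : ∀ i < M, K i ≤ K (M + i)
  le_one : ∀ i < M, K (M + i) ≤ 1

/-- Some interval of `v` contains `t`. -/
def Covers (M : ℕ) (V : ℕ → ℕ) (K : ℕ → ℝ) (v : ℕ) (t : ℝ) : Prop :=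
  ∃ i < M, V i = v ∧ K i ≤ t ∧ t ≤ K (M + i)

/-- All `v < p` other than `r` have an interval that contains `t`. -/
def CoversAll (p r M : ℕ) (V : ℕ → ℕ) (K : ℕ → ℝ) (t : ℝ) : Prop :=
  ∀ v < p, v ≠ r → Covers M V K v t

/-- The number of intervals of `v` that are open when the items in `D` have been passed. -/
def openCount (M : ℕ) (V : ℕ → ℕ) (D : Finset ℕ) (v : ℕ) : ℕ :=
  ((Finset.range M).filter fun j => V j = v ∧ j ∈ D ∧ M + j ∉ D).card

/-- Only interval `l` changes its status: a number below `M` is no end point. -/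
theorem openCount_insert_start {M l : ℕ} {V : ℕ → ℕ} {D : Finset ℕ} (hl : l < M) (h1 : l ∉ D)
    (h2 : M + l ∉ D) (v : ℕ) :
    openCount M V (insert l D) v = openCount M V D v + if v = V l then 1 else 0 := by
  unfold openCount
  split_ifs with hv
  · have : (Finset.range M).filter (fun j => V j = v ∧ j ∈ insert l D ∧ M + j ∉ insert l D) =
        insert l ((Finset.range M).filter fun j => V j = v ∧ j ∈ D ∧ M + j ∉ D) := by
      ext j
      have : M + j ≠ l := by omega
      by_cases hj : j = l
      · subst hj
        have : M ≠ 0 := by omega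
        simp [hl, hv, h2, this]
      · simp [hj, this]
    rw [this, Finset.card_insert_of_notMem (by simp [h1])]
  · rw [add_zero]
    congr 1
    ext j
    have : M + j ≠ l := by omega
    by_cases hj : j = l
    · subst hj
      simp [Ne.symm hv]
    · simp [hj, this]

theorem openCount_insert_end {M l : ℕ} {V : ℕ → ℕ} {D : Finset ℕ} (hl : l < M) (h1 : l ∈ D)
    (h2 : M + l ∉ D) (v : ℕ) :
    openCount M V D v = openCount M V (insert (M + l) D) v + if v = V l then 1 else 0 := by
  unfold openCount
  split_ifs with hv
  · have : (Finset.range M).filter (fun j => V j = v ∧ j ∈ D ∧ M + j ∉ D) =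
        insert l ((Finset.range M).filter
          fun j => V j = v ∧ j ∈ insert (M + l) D ∧ M + j ∉ insert (M + l) D) := by
      ext j
      by_cases hj : j = l
      · subst hj
        simp [hl, hv, h2, h1]
      · have h3 : j < M → j ≠ M + l := by omega
        simp only [Finset.mem_filter, Finset.mem_range, Finset.mem_insert, hj, false_or,
          add_right_inj]
        exact and_congr_right fun h => by simp [h3 h]
    rw [this, Finset.card_insert_of_notMem (by simp)]
  · rw [add_zero]
    congr 1
    ext j
    by_cases hj : j = l
    · subst hj
      simp [Ne.symm hv]
    · have h3 : j < M → j ≠ M + l := by omega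
      simp only [Finset.mem_filter, Finset.mem_range, Finset.mem_insert, hj,
        add_right_inj, not_or, not_false_eq_true, true_and]
      exact and_congr_right fun h => by simp [h3 h]

/-- Take out the first item, adapt the counters, and note whether everything is covered. -/
def sweepItem : Program :=
  .seq (.setNat 12 (.sub (.reg 12) (.const 1)))
    (.seq (.setNat 15 (.arr 3 (.const 1)))
      (.seq (.setNat 6 (.arr 2 (.reg 15)))
        (.seq account
          (.seq (.ite (.natEq (.reg 13) (.reg 0)) (.setNat 14 (.const 1)) .skip)
            (.seq (.setRealArr 2 (.reg 15) (.const 2)) (.setNat 9 (.add (.reg 8) (.reg 15))))))))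

theorem sweepItem_spec {p v l : ℕ} {s : State} (h13 : s.natReg 13 = posCount p (s.natArr 5))
    (hl : s.natArr 3 1 = l) (h6 : s.natArr 2 l = v) (hv : v < p)
    (hpos : s.natReg 5 ≤ l → 0 < s.natArr 5 v) :
    (sweepItem.run s).natArr 5 = Function.update (s.natArr 5) v
      (if l < s.natReg 5 then s.natArr 5 v + 1 else s.natArr 5 v - 1) ∧
    (sweepItem.run s).natReg 13 = posCount p ((sweepItem.run s).natArr 5) ∧
    (sweepItem.run s).realArr 2 = Function.update (s.realArr 2) l 2 ∧
    (sweepItem.run s).natReg 14 =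
      (if (sweepItem.run s).natReg 13 = s.natReg 0 then 1 else s.natReg 14) ∧
    (sweepItem.run s).natReg 9 = s.natReg 8 + l ∧
    (sweepItem.run s).natReg 12 = s.natReg 12 - 1 ∧
    (∀ x, x ∉ [6, 9, 12, 13, 14, 15] → (sweepItem.run s).natReg x = s.natReg x) ∧
    (∀ a, a ≠ 5 → (sweepItem.run s).natArr a = s.natArr a) := by
  set u := ((s.putNat 12 (s.natReg 12 - 1)).putNat 15 l).putNat 6 v with hu
  have e : sweepItem.run s = (Program.seq
      (.ite (.natEq (.reg 13) (.reg 0)) (.setNat 14 (.const 1)) .skip)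
      (.seq (.setRealArr 2 (.reg 15) (.const 2)) (.setNat 9 (.add (.reg 8) (.reg 15))))).run
      (account.run u) := by
    have h' : (Program.setNat 6 (.arr 2 (.reg 15))).run ((Program.setNat 15 (.arr 3 (.const 1))).run
        ((Program.setNat 12 (.sub (.reg 12) (.const 1))).run s)) = u := by
      simp [Program.run, NatExp.eval, hu, hl, h6]
    rw [← h']
    rfl
  obtain ⟨a1, a2, a3⟩ := account_spec (p := p) (v := v) (s := u) (by simpa [hu] using h13)
    (by simp [hu]) hv (by simpa [hu] using hpos)
  have b15 : (account.run u).natReg 15 = l := by rw [a3.natReg 15 (by decide)]; simp [hu]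
  have b0 : (account.run u).natReg 0 = s.natReg 0 := by
    rw [a3.natReg 0 (by decide)]; simp [hu]
  have b8 : (account.run u).natReg 8 = s.natReg 8 := by
    rw [a3.natReg 8 (by decide)]; simp [hu]
  have b12 : (account.run u).natReg 12 = s.natReg 12 - 1 := by
    rw [a3.natReg 12 (by decide)]; simp [hu]
  have b14 : (account.run u).natReg 14 = s.natReg 14 := by
    rw [a3.natReg 14 (by decide)]; simp [hu]
  have bK : (account.run u).realArr = s.realArr := a3.realArr
  have u5 : u.natArr = s.natArr := rfl
  have ur5 : u.natReg 5 = s.natReg 5 := by simp [hu]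
  have ur15 : u.natReg 15 = l := by simp [hu]
  rw [u5, ur5, ur15] at a1
  rw [e]
  generalize account.run u = w at *
  have bX : ∀ x, x ∉ [6, 9, 12, 13, 14, 15] → w.natReg x = s.natReg x := by
    intro x hx
    simp only [List.mem_cons, List.not_mem_nil, or_false, not_or] at hx
    rw [a3.natReg x (by simp [hx])]
    simp [hu, hx]
  have bA : ∀ a, a ≠ 5 → w.natArr a = s.natArr a := fun a ha => a3.natArr a (by simpa using ha)
  by_cases h : w.natReg 13 = s.natReg 0
  · refine ⟨?_, ?_, ?_, ?_, ?_, ?_, fun x hx => ?_, fun a ha => ?_⟩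
    · simp [Program.run, Test.eval, NatExp.eval, RealExp.eval, b0, h, a1]
    · simpa [Program.run, Test.eval, NatExp.eval, RealExp.eval, b0, h] using a2
    · simp [Program.run, Test.eval, NatExp.eval, RealExp.eval, b0, b15, bK, h]
    · simp [Program.run, Test.eval, NatExp.eval, RealExp.eval, b0, h]
    · simp [Program.run, Test.eval, NatExp.eval, RealExp.eval, b0, b15, b8, h]
    · simp [Program.run, Test.eval, NatExp.eval, RealExp.eval, b0, b12, h]
    · rw [← bX x hx]
      simp only [List.mem_cons, List.not_mem_nil, or_false, not_or] at hx
      simp [Program.run, Test.eval, NatExp.eval, RealExp.eval, b0, h, hx]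
    · rw [← bA a ha]
      simp [Program.run, Test.eval, NatExp.eval, RealExp.eval, b0, h]
  · refine ⟨?_, ?_, ?_, ?_, ?_, ?_, fun x hx => ?_, fun a ha => ?_⟩
    · simp [Program.run, Test.eval, NatExp.eval, RealExp.eval, b0, h, a1]
    · simpa [Program.run, Test.eval, NatExp.eval, RealExp.eval, b0, h] using a2
    · simp [Program.run, Test.eval, NatExp.eval, RealExp.eval, b0, b15, bK, h]
    · simp [Program.run, Test.eval, NatExp.eval, RealExp.eval, b0, b14, h]
    · simp [Program.run, Test.eval, NatExp.eval, RealExp.eval, b0, b15, b8, h]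
    · simp [Program.run, Test.eval, NatExp.eval, RealExp.eval, b0, b12, h]
    · rw [← bX x hx]
      simp only [List.mem_cons, List.not_mem_nil, or_false, not_or] at hx
      simp [Program.run, Test.eval, NatExp.eval, RealExp.eval, b0, h, hx]
    · rw [← bA a ha]
      simp [Program.run, Test.eval, NatExp.eval, RealExp.eval, b0, h]

end RealRAM

/-! ### Correctness and step count of the sweep. -/

namespace RealRAM

/-- The state of the sweep when the items in `D` have been passed. -/
structure SweepInv (p r M : ℕ) (V : ℕ → ℕ) (K : ℕ → ℝ) (D : Finset ℕ) (s : State) : Prop where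
  reg0 : s.natReg 0 = p
  reg5 : s.natReg 5 = M
  reg8 : s.natReg 8 = 2 * M
  reg12 : s.natReg 12 + D.card = 2 * M
  arrV : s.natArr 2 = V
  arrK : s.realArr 2 = fun j => if j ∈ D then 2 else K j
  parent : ∀ i, 2 ≤ i → i < 2 * (2 * M) → s.natArr 4 i = i / 2
  sub : ∀ x ∈ D, x < 2 * M
  sorted : ∀ x ∈ D, ∀ y < 2 * M, y ∉ D → KeyLE K x y
  cnt : ∀ v < p, s.natArr 5 v = (if v = r then 1 else 0) + openCount M V D v
  cov : s.natReg 13 = posCount p (s.natArr 5)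
  ans : s.natReg 14 = 0 ∨ s.natReg 14 = 1
  sound : s.natReg 14 = 1 → ∃ t, 0 ≤ t ∧ t ≤ 1 ∧ CoversAll p r M V K t
  complete : s.natReg 14 = 0 → ∀ t, CoversAll p r M V K t → ∃ i < M, i ∉ D ∧ K i ≤ t

theorem posCount_eq_iff {p : ℕ} {c : ℕ → ℕ} : posCount p c = p ↔ ∀ v < p, 0 < c v := by
  unfold posCount
  conv_lhs => rhs; rw [← Finset.card_range p]
  rw [Finset.card_filter_eq_iff]
  simp

theorem openCount_pos_iff {M : ℕ} {V : ℕ → ℕ} {D : Finset ℕ} {v : ℕ} :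
    0 < openCount M V D v ↔ ∃ j < M, V j = v ∧ j ∈ D ∧ M + j ∉ D := by
  simp [openCount, Finset.card_pos, Finset.Nonempty]

theorem Intervals.key_mem {p M : ℕ} {V : ℕ → ℕ} {K : ℕ → ℝ} (h : Intervals p M V K) {j : ℕ}
    (hj : j < 2 * M) : 0 ≤ K j ∧ K j ≤ 1 := by
  by_cases hjM : j < M
  · exact ⟨h.nonneg j hjM, (h.le j hjM).trans (h.le_one j hjM)⟩
  · obtain ⟨i, rfl⟩ := Nat.exists_eq_add_of_le (not_lt.mp hjM)
    have hi : i < M := by omega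
    exact ⟨(h.nonneg i hi).trans (h.le i hi), h.le_one i hi⟩

/-- Ties are broken by number and all starts are numbered before all ends, so even a one-point
interval is opened before it is closed. -/
theorem not_keyLE_end_start {p M : ℕ} {V : ℕ → ℕ} {K : ℕ → ℝ} (h : Intervals p M V K) {i : ℕ}
    (hi : i < M) : ¬ KeyLE K (M + i) i := by
  rintro (h' | ⟨-, h'⟩)
  · exact absurd (h.le i hi) (not_le.mpr h')
  · omega

/-- The root of the tree holds the first of the remaining items. -/
theorem SweepInv.first {p r M : ℕ} {V : ℕ → ℕ} {K : ℕ → ℝ} {D : Finset ℕ} {s : State}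
    (hI : Intervals p M V K) (h : SweepInv p r M V K D s)
    (htree : Tree (2 * M) (s.realArr 2) (s.natArr 3) 1 (fun _ => False)) (h12 : 0 < s.natReg 12) :
    s.natArr 3 1 < 2 * M ∧ s.natArr 3 1 ∉ D ∧
      ∀ y < 2 * M, y ∉ D → KeyLE K (s.natArr 3 1) y := by
  have hc := h.reg12
  obtain ⟨y, hy, hyD⟩ : ∃ y < 2 * M, y ∉ D := by
    by_contra! hall
    have : Finset.range (2 * M) ⊆ D := fun y hy => hall y (Finset.mem_range.mp hy)
    have := Finset.card_le_card this
    rw [Finset.card_range] at this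
    omega
  have hl := (htree.desc 1 le_rfl le_rfl (by omega)).1
  have hlD : s.natArr 3 1 ∉ D := by
    -- A passed item has key `2`, whereas the remaining item `y` has a key at most `1` and would
    -- beat it.
    intro hlD
    have h1 := htree.root_le hy
    have h2 := (hI.key_mem hy).2
    rw [h.arrK] at h1
    simp only [KeyLE, if_pos hlD, if_neg hyD] at h1
    rcases h1 with h1 | ⟨h1, -⟩ <;> linarith
  refine ⟨hl, hlD, fun z hz hzD => ?_⟩
  have h1 := htree.root_le hz
  rw [h.arrK] at h1
  simpa only [KeyLE, if_neg hlD, if_neg hzD] using h1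

/-- Soundness: if all vertices have an open interval after `l` is passed, all of these contain `K
l`. Completeness: if `t` is covered for all vertices, then once the last start at or before `t` is
passed, no interval containing `t` has been closed, so the full count is seen at that moment. -/
theorem SweepInv.step {p r M : ℕ} {V : ℕ → ℕ} {K : ℕ → ℝ} {D : Finset ℕ} {s : State}
    (hI : Intervals p M V K) (h : SweepInv p r M V K D s)
    (htree : Tree (2 * M) (s.realArr 2) (s.natArr 3) 1 (fun _ => False)) (h12 : 0 < s.natReg 12) :
    ∃ l < 2 * M, SweepInv p r M V K (insert l D) (sweepItem.run s) ∧
      (sweepItem.run s).natReg 9 = 2 * M + l ∧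
      (sweepItem.run s).natReg 12 + 1 = s.natReg 12 ∧
      Tree (2 * M) ((sweepItem.run s).realArr 2) ((sweepItem.run s).natArr 3) 1
        (fun k => ∃ m, (2 * M + l) / 2 ^ (m + 1) = k) := by
  obtain ⟨hl, hlD, hmin⟩ := h.first hI htree h12
  set l := s.natArr 3 1 with hl_def
  have hstart : l < M → M + l ∉ D := fun h1 h2 =>
    not_keyLE_end_start hI h1 (h.sorted _ h2 l hl hlD)
  have hend : ∀ i, l = M + i → i < M ∧ i ∈ D := by
    intro i hi
    have hiM : i < M := by omega
    refine ⟨hiM, by_contra fun hiD => not_keyLE_end_start hI hiM ?_⟩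
    rw [← hi]
    exact hmin i (by omega) hiD
  have hv : V l < p := by
    by_cases hlM : l < M
    · exact hI.lt l hlM
    · obtain ⟨i, hi⟩ := Nat.exists_eq_add_of_le (not_lt.mp hlM)
      rw [hi, hI.eq i (hend i hi).1]
      exact hI.lt i (hend i hi).1
  obtain ⟨a5, a13, aK, a14, a9, a12, aX, aA⟩ := sweepItem_spec h.cov hl_def.symm
    (congrFun h.arrV l) hv (by
      intro h5
      rw [h.reg5] at h5
      obtain ⟨i, hi⟩ := Nat.exists_eq_add_of_le h5
      rw [h.cnt _ hv]
      refine Nat.add_pos_right _ (openCount_pos_iff.mpr ⟨i, (hend i hi).1, ?_, (hend i hi).2, ?_⟩)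
      · rw [hi, hI.eq i (hend i hi).1]
      · rwa [← hi])
  -- The summand for `v = r` is the permanent unit that keeps the root covered.
  have hcnt : ∀ v < p, (sweepItem.run s).natArr 5 v =
      (if v = r then 1 else 0) + openCount M V (insert l D) v := by
    intro v hvp
    rw [a5, h.reg5]
    by_cases hlM : l < M
    · rw [if_pos hlM, openCount_insert_start hlM hlD (hstart hlM)]
      by_cases hvl : v = V l
      · subst hvl
        rw [Function.update_self, h.cnt _ hv, if_pos rfl]
        ring
      · rw [Function.update_of_ne hvl, h.cnt _ hvp, if_neg hvl, add_zero]
    · rw [if_neg hlM]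
      obtain ⟨i, hi⟩ := Nat.exists_eq_add_of_le (not_lt.mp hlM)
      have hVi : V l = V i := by rw [hi, hI.eq i (hend i hi).1]
      have key := openCount_insert_end (V := V) (hend i hi).1 (hend i hi).2 (hi ▸ hlD) v
      rw [← hi, ← hVi] at key
      by_cases hvl : v = V l
      · subst hvl
        rw [if_pos rfl] at key
        rw [Function.update_self, h.cnt _ hv, key]
        omega
      · rw [if_neg hvl] at key
        rw [Function.update_of_ne hvl, h.cnt _ hvp, key, add_zero]
  have hsorted : ∀ x ∈ insert l D, ∀ y < 2 * M, y ∉ insert l D → KeyLE K x y := by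
    intro x hx y hy hyD
    rw [Finset.mem_insert, not_or] at hyD
    rcases Finset.mem_insert.mp hx with rfl | hx
    · exact hmin y hy hyD.2
    · exact h.sorted x hx y hy hyD.2
  have hle : ∀ x ∈ insert l D, KeyLE K x l := by
    intro x hx
    rcases Finset.mem_insert.mp hx with rfl | hx
    · exact .refl _ _
    · exact h.sorted x hx l hl hlD
  have keyle : ∀ {x y}, KeyLE K x y → K x ≤ K y := fun h => h.elim le_of_lt fun h => h.1.le
  have hfull : (sweepItem.run s).natReg 13 = p ↔
      ∀ v < p, v ≠ r → ∃ j < M, V j = v ∧ j ∈ insert l D ∧ M + j ∉ insert l D := by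
    rw [a13, posCount_eq_iff]
    refine forall₂_congr fun v hvp => ?_
    rw [hcnt v hvp, ← openCount_pos_iff]
    split_ifs with h' <;> simp [h']
  have hK2 : (sweepItem.run s).realArr 2 = fun j => if j ∈ insert l D then 2 else K j := by
    rw [aK, h.arrK]
    ext j
    by_cases hj : j = l
    · subst hj; simp
    · simp [hj]
  refine ⟨l, hl, ⟨?_, ?_, ?_, ?_, ?_, ?_, ?_, ?_, hsorted, hcnt, a13, ?_, ?_, ?_⟩, ?_, ?_, ?_⟩
  · rw [aX 0 (by decide), h.reg0]
  · rw [aX 5 (by decide), h.reg5]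
  · rw [aX 8 (by decide), h.reg8]
  · rw [a12, Finset.card_insert_of_notMem hlD]
    have := h.reg12
    omega
  · rw [aA 2 (by decide), h.arrV]
  · exact hK2
  · rw [aA 4 (by decide)]
    exact h.parent
  · intro x hx
    rcases Finset.mem_insert.mp hx with rfl | hx
    · exact hl
    · exact h.sub x hx
  · rw [a14]
    split_ifs
    · exact .inr rfl
    · exact h.ans
  · intro h1
    rw [a14, h.reg0] at h1
    split_ifs at h1 with hp
    -- The witness is the current position: passed starts lie at or before it, remaining ends at or
    -- after it.
    · refine ⟨K l, (hI.key_mem hl).1, (hI.key_mem hl).2, fun v hvp hvr => ?_⟩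
      obtain ⟨j, hj, h2, h3, h4⟩ := hfull.mp hp v hvp hvr
      refine ⟨j, hj, h2, keyle (hle j h3), keyle (hsorted l (Finset.mem_insert_self _ _) _
        (by omega) h4)⟩
    · exact h.sound h1
  · intro h1 t ht
    rw [a14, h.reg0] at h1
    split_ifs at h1 with hp
    by_contra! hall
    refine hp (hfull.mpr fun v hvp hvr => ?_)
    obtain ⟨i, hi, hiD, hit⟩ := h.complete h1 t ht
    -- Before this step a start at or before `t` remained, after it none does; hence it is the item
    -- just passed.
    obtain rfl : i = l := by
      by_contra hil
      exact absurd hit (not_le.mpr (hall i hi (by simp [hil, hiD])))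
    obtain ⟨j, hj, h2, h3, h4⟩ := ht v hvp hvr
    refine ⟨j, hj, h2, by_contra fun h5 => absurd h3 (not_le.mpr (hall j hj h5)), fun h5 => ?_⟩
    -- An end passed no later than the start `i` lies strictly before it, because ties favour
    -- starts; but this end is at or after `t ≥ K i`.
    rcases hle _ h5 with h6 | ⟨-, h6⟩
    · linarith
    · omega
  · rw [a9, h.reg8]
  · rw [a12]
    omega
  · rw [aK, aA 3 (by decide)]
    refine htree.update_key l ?_
    rw [h.arrK]
    simp only [if_neg hlD]
    linarith [(hI.key_mem hl).2]

/-- Prepare the counters; the root `r` counts as covered from the start. -/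
def sweepInit : Program :=
  .seq (.setNat 13 (.const 1))
    (.seq (.setNatArr 5 (.reg 2) (.const 1))
      (.seq (.setNat 12 (.reg 8))
        (.ite (.natEq (.reg 13) (.reg 0)) (.setNat 14 (.const 1)) .skip)))

/-- Decide whether some `t` is covered by intervals of all vertices. -/
def sweep : Program :=
  .seq (.setNat 8 (.add (.reg 5) (.reg 5)))
    (.seq build
      (.seq sweepInit
        (.seq (.loop (.natLt (.const 0) (.reg 12)) (.seq sweepItem repair))
          (.setNat 0 (.reg 14)))))

theorem sweepInit_spec {p r M : ℕ} {V : ℕ → ℕ} {K : ℕ → ℝ} {s : State} (hr : r < p)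
    (h0 : s.natReg 0 = p) (h2 : s.natReg 2 = r) (h5 : s.natReg 5 = M)
    (h8 : s.natReg 8 = 2 * M) (h14 : s.natReg 14 = 0) (hV : s.natArr 2 = V)
    (hK : s.realArr 2 = K) (hpar : ∀ i, 2 ≤ i → i < 2 * (2 * M) → s.natArr 4 i = i / 2)
    (hc : ∀ v, s.natArr 5 v = 0) :
    SweepInv p r M V K ∅ (sweepInit.run s) ∧ (sweepInit.run s).realArr = s.realArr ∧
      (sweepInit.run s).natArr 3 = s.natArr 3 := by
  have hc' : s.natArr 5 = fun _ => 0 := funext hc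
  have e0 : (sweepInit.run s).natReg 0 = p := by
    by_cases h : 1 = p <;> simp [sweepInit, Program.run, Test.eval, NatExp.eval, h0, h]
  have e5 : (sweepInit.run s).natReg 5 = M := by
    by_cases h : 1 = p <;> simp [sweepInit, Program.run, Test.eval, NatExp.eval, h0, h5, h]
  have e8 : (sweepInit.run s).natReg 8 = 2 * M := by
    by_cases h : 1 = p <;> simp [sweepInit, Program.run, Test.eval, NatExp.eval, h0, h8, h]
  have e12 : (sweepInit.run s).natReg 12 = 2 * M := by
    by_cases h : 1 = p <;> simp [sweepInit, Program.run, Test.eval, NatExp.eval, h0, h8, h]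
  have e13 : (sweepInit.run s).natReg 13 = 1 := by
    by_cases h : 1 = p <;> simp [sweepInit, Program.run, Test.eval, NatExp.eval, h0, h]
  have e14 : (sweepInit.run s).natReg 14 = if 1 = p then 1 else 0 := by
    by_cases h : 1 = p <;> simp [sweepInit, Program.run, Test.eval, NatExp.eval, h0, h14, h]
  have eA : ∀ a, a ≠ 5 → (sweepInit.run s).natArr a = s.natArr a := by
    intro a ha
    by_cases h : 1 = p <;> simp [sweepInit, Program.run, Test.eval, NatExp.eval, h0, ha, h]
  have e5' : (sweepInit.run s).natArr 5 = Function.update (fun _ => 0) r 1 := by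
    by_cases h : 1 = p <;> simp [sweepInit, Program.run, Test.eval, NatExp.eval, h0, h2, hc', h]
  have eK : (sweepInit.run s).realArr = s.realArr := by
    by_cases h : 1 = p <;> simp [sweepInit, Program.run, Test.eval, NatExp.eval, h0, h]
  refine ⟨⟨e0, e5, e8, by simpa using e12, by rw [eA 2 (by decide), hV], by simp [eK, hK],
    by rwa [eA 4 (by decide)], by simp, by simp, ?_, ?_, ?_, ?_, ?_⟩, eK, eA 3 (by decide)⟩
  · intro v _
    rw [e5', Function.update_apply]
    simp [openCount]
  · rw [e13, e5', posCount_update_pos hr rfl one_pos]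
    simp [posCount]
  · rw [e14]
    split_ifs <;> simp
  · rw [e14]
    split_ifs with hp
    · rintro -
      -- With a single point there is nothing to cover, and any `t` will do.
      exact ⟨0, le_rfl, zero_le_one, fun v hv hvr => by omega⟩
    · simp
  · rw [e14]
    split_ifs with hp
    · simp
    · rintro - t ht
      obtain ⟨v, hv, hvr⟩ : ∃ v < p, v ≠ r := by
        by_cases hr0 : r = 0
        · exact ⟨1, by omega, by omega⟩
        · exact ⟨0, by omega, Ne.symm hr0⟩
      obtain ⟨i, hi, -, h', -⟩ := ht v hv hvr
      exact ⟨i, hi, by simp, h'⟩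

/-- Leaf numbers are below `4 * M ≤ 2 ^ (L + 1)`, so each of the `2 * M` repairs climbs at most `L`
levels. -/
theorem sweep_runs {p r M L : ℕ} {V : ℕ → ℕ} {K : ℕ → ℝ} {s : State} (hI : Intervals p M V K)
    (hr : r < p) (h0 : s.natReg 0 = p) (h2 : s.natReg 2 = r) (h5 : s.natReg 5 = M)
    (h14 : s.natReg 14 = 0) (hV : s.natArr 2 = V) (hK : s.realArr 2 = K)
    (hc : ∀ v, s.natArr 5 v = 0) (hL : 2 * M ≤ 2 ^ L) :
    Runs sweep s (4 + (2 * M * (fillStep.bound + buildStep.bound + 6) + 10 + (sweepInit.bound +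
      (2 * M * (sweepItem.bound + (L * (repairStep.bound + 3) + 3) + 3) + 3 + 2)))) (fun s' =>
      (s'.natReg 0 = 0 ∨ s'.natReg 0 = 1) ∧
      (s'.natReg 0 = 1 ↔ ∃ t, 0 ≤ t ∧ t ≤ 1 ∧ CoversAll p r M V K t)) := by
  refine Runs.seq (Runs.of_run (c := .setNat 8 (.add (.reg 5) (.reg 5))) (Q := (· = _)) rfl) ?_
  rintro _ rfl
  have e8 : ((Program.setNat 8 (.add (.reg 5) (.reg 5))).run s).natReg 8 = 2 * M := by
    simp [Program.run, NatExp.eval, h5, two_mul]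
  have eX : ∀ x, x ≠ 8 →
      ((Program.setNat 8 (.add (.reg 5) (.reg 5))).run s).natReg x = s.natReg x := by
    intro x hx
    simp [Program.run, hx]
  have eA : ((Program.setNat 8 (.add (.reg 5) (.reg 5))).run s).natArr = s.natArr := rfl
  have eK : ((Program.setNat 8 (.add (.reg 5) (.reg 5))).run s).realArr = s.realArr := rfl
  generalize (Program.setNat 8 (.add (.reg 5) (.reg 5))).run s = u at *
  refine Runs.seq (build_runs e8) ?_
  rintro w ⟨htree, hpar, hF⟩
  have w0 : w.natReg 0 = p := by rw [hF.natReg 0 (by decide), eX 0 (by decide), h0]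
  have w2 : w.natReg 2 = r := by rw [hF.natReg 2 (by decide), eX 2 (by decide), h2]
  have w5 : w.natReg 5 = M := by rw [hF.natReg 5 (by decide), eX 5 (by decide), h5]
  have w8 : w.natReg 8 = 2 * M := by rw [hF.natReg 8 (by decide), e8]
  have w14 : w.natReg 14 = 0 := by rw [hF.natReg 14 (by decide), eX 14 (by decide), h14]
  have wV : w.natArr 2 = V := by rw [hF.natArr 2 (by decide), eA, hV]
  have wK : w.realArr 2 = K := by rw [hF.realArr, eK, hK]
  have wc : ∀ v, w.natArr 5 v = 0 := by rw [hF.natArr 5 (by decide), eA]; exact hc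
  refine Runs.seq (Runs.of_run (c := sweepInit) (Q := (· = _)) rfl) ?_
  rintro _ rfl
  obtain ⟨hs, hs1, hs2⟩ := sweepInit_spec hr w0 w2 w5 w8 w14 wV wK hpar wc
  rw [← hs1, ← hs2] at htree
  generalize sweepInit.run w = z at *
  refine Runs.seq (Runs.loop (fun n s' => s'.natReg 12 = n ∧ ∃ D,
    SweepInv p r M V K D s' ∧
    Tree (2 * M) (s'.realArr 2) (s'.natArr 3) 1 (fun _ => False)) ?_
    (n := 2 * M) ⟨by simpa using hs.reg12, ∅, hs, htree⟩) ?_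
  · rintro n s' ⟨rfl, D, h1, h2⟩ h3
    have h3 : 0 < s'.natReg 12 := h3
    obtain ⟨l, hl, a1, a2, a3, a4⟩ := h1.step hI h2 h3
    refine ⟨(sweepItem.run s').natReg 12, a3.symm, ?_⟩
    refine Runs.seq (Runs.of_run (c := sweepItem) (Q := (· = _)) rfl) ?_
    rintro _ rfl
    generalize sweepItem.run s' = y at *
    refine (repair_runs (N := 2 * M) (n := L) (by rwa [a2]) (by omega) a1.parent
      (by rw [pow_succ]; omega)).mono le_rfl ?_
    rintro x ⟨b1, b2⟩
    refine ⟨b2.natReg 12 (by decide), insert l D, ?_, b1⟩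
    refine ⟨?_, ?_, ?_, ?_, ?_, ?_, ?_, a1.sub, a1.sorted, ?_, ?_, ?_, ?_, ?_⟩
    · rw [b2.natReg 0 (by decide), a1.reg0]
    · rw [b2.natReg 5 (by decide), a1.reg5]
    · rw [b2.natReg 8 (by decide), a1.reg8]
    · rw [b2.natReg 12 (by decide), a1.reg12]
    · rw [b2.natArr 2 (by decide), a1.arrV]
    · rw [b2.realArr, a1.arrK]
    · rw [b2.natArr 4 (by decide)]; exact a1.parent
    · rw [b2.natArr 5 (by decide)]; exact a1.cnt
    · rw [b2.natArr 5 (by decide), b2.natReg 13 (by decide)]; exact a1.cov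
    · rw [b2.natReg 14 (by decide)]; exact a1.ans
    · rw [b2.natReg 14 (by decide)]; exact a1.sound
    · rw [b2.natReg 14 (by decide)]; exact a1.complete
  · rintro s' ⟨⟨n, rfl, D, h1, -⟩, h3⟩
    have h3 : ¬ 0 < s'.natReg 12 := h3
    refine Runs.of_run (c := .setNat 0 (.reg 14)) ?_
    have e : ((Program.setNat 0 (.reg 14)).run s').natReg 0 = s'.natReg 14 := by
      simp [Program.run, NatExp.eval]
    rw [e]
    refine ⟨h1.ans, h1.sound, ?_⟩
    rintro ⟨t, -, -, ht⟩
    -- If the answer were still `0`, a covered `t` would leave some start unpassed, but by now all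
    -- items are passed.
    refine h1.ans.resolve_left fun h0 => ?_
    obtain ⟨i, hi, hiD, -⟩ := h1.complete h0 t ht
    refine hiD ?_
    have hD : D = Finset.range (2 * M) := Finset.eq_of_subset_of_card_le
      (fun x hx => Finset.mem_range.mpr (h1.sub x hx)) (by
        rw [Finset.card_range]
        have := h1.reg12
        omega)
    rw [hD, Finset.mem_range]
    omega

end RealRAM

namespace RealRAM

/-! ### Computing the intervals -/

/-- Intersect the interval `[lo, hi]` in the real registers `0` and `1` with the set of all `t`
such that `0 ≤ α + β * t`, where `α` and `β` are in the real registers `2` and `3`. -/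
def clip : Program :=
  .ite (.realLt (.const 0) (.reg 3))
    (.ite (.realLt (.reg 0) (.div (.sub (.const 0) (.reg 2)) (.reg 3)))
      (.setReal 0 (.div (.sub (.const 0) (.reg 2)) (.reg 3))) .skip)
    (.ite (.realLt (.reg 3) (.const 0))
      (.ite (.realLt (.div (.sub (.const 0) (.reg 2)) (.reg 3)) (.reg 1))
        (.setReal 1 (.div (.sub (.const 0) (.reg 2)) (.reg 3))) .skip)
      (.ite (.realLt (.reg 2) (.const 0)) (.setReal 1 (.sub (.reg 0) (.const 1))) .skip))

/-- The interval in the real registers `0` and `1` contains `t`. -/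
def State.Has (s : State) (t : ℝ) : Prop := s.realReg 0 ≤ t ∧ t ≤ s.realReg 1

/-- Only the real registers `0` to `3` differ. -/
structure RealFrame (s s' : State) : Prop where
  natReg : s'.natReg = s.natReg
  natArr : s'.natArr = s.natArr
  realArr : s'.realArr = s.realArr
  realReg : ∀ x, 4 ≤ x → s'.realReg x = s.realReg x

theorem RealFrame.trans {s s' s'' : State} (h : RealFrame s s') (h' : RealFrame s' s'') :
    RealFrame s s'' :=
  ⟨h'.natReg.trans h.natReg, h'.natArr.trans h.natArr, h'.realArr.trans h.realArr,
    fun x hx => (h'.realReg x hx).trans (h.realReg x hx)⟩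

/-- The sign of the slope decides which end is moved to the zero `-a / b`. Phrasing the result by
membership covers empty intervals without a separate case. -/
theorem clip_spec (s : State) :
    (∀ t, (clip.run s).Has t ↔ s.Has t ∧ 0 ≤ s.realReg 2 + s.realReg 3 * t) ∧
      RealFrame s (clip.run s) := by
  set lo := s.realReg 0 with hlo
  set hi := s.realReg 1 with hhi
  set a := s.realReg 2 with ha
  set b := s.realReg 3 with hb
  have f0 : ∀ w, RealFrame s (s.putReal 0 w) := fun w => ⟨rfl, rfl, rfl, fun x hx => by
    have : x ≠ 0 := by omega
    simp [this]⟩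
  have f1 : ∀ w, RealFrame s (s.putReal 1 w) := fun w => ⟨rfl, rfl, rfl, fun x hx => by
    have : x ≠ 1 := by omega
    simp [this]⟩
  have f : RealFrame s s := ⟨rfl, rfl, rfl, fun _ _ => rfl⟩
  rcases lt_trichotomy b 0 with h | h | h
  · have key : ∀ t, 0 ≤ a + b * t ↔ t ≤ -a / b := fun t => by
      rw [le_div_iff_of_neg h]
      constructor <;> intro <;> linarith
    by_cases h' : -a / b < hi
    · have e : clip.run s = s.putReal 1 (-a / b) := by
        simp [clip, Program.run, Test.eval, RealExp.eval, ← ha, ← hb, ← hhi, h, h.le, h']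
      rw [e]
      refine ⟨fun t => ?_, f1 _⟩
      simp only [State.Has, State.putReal_realReg, if_true, key, ← hlo, ← hhi]
      simp only [zero_ne_one, if_false]
      exact ⟨fun ⟨h1, h2⟩ => ⟨⟨h1, h2.trans h'.le⟩, h2⟩, fun ⟨h1, h2⟩ => ⟨h1.1, h2⟩⟩
    · have e : clip.run s = s := by
        simp [clip, Program.run, Test.eval, RealExp.eval, ← ha, ← hb, ← hhi, h, h.le, h']
      rw [e]
      refine ⟨fun t => ?_, f⟩
      rw [key]
      exact ⟨fun h1 => ⟨h1, h1.2.trans (not_lt.mp h')⟩, fun h1 => h1.1⟩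
  · by_cases h' : a < 0
    -- The inequality is constant and false; an upper end below the lower one encodes the empty set.
    · have e : clip.run s = s.putReal 1 (lo - 1) := by
        simp [clip, Program.run, Test.eval, RealExp.eval, ← ha, ← hb, ← hlo, h, h']
      rw [e]
      refine ⟨fun t => ?_, f1 _⟩
      simp only [State.Has, State.putReal_realReg, if_true, ← hlo, ← hhi, h]
      simp only [zero_ne_one, if_false]
      constructor
      · rintro ⟨h1, h2⟩
        linarith
      · rintro ⟨-, h1⟩
        linarith
    · have e : clip.run s = s := by
        simp [clip, Program.run, Test.eval, RealExp.eval, ← ha, ← hb, h, h']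
      rw [e]
      refine ⟨fun t => ?_, f⟩
      rw [h]
      exact ⟨fun h1 => ⟨h1, by linarith⟩, fun h1 => h1.1⟩
  · have key : ∀ t, 0 ≤ a + b * t ↔ -a / b ≤ t := fun t => by
      rw [div_le_iff₀ h]
      constructor <;> intro <;> linarith
    by_cases h' : lo < -a / b
    · have e : clip.run s = s.putReal 0 (-a / b) := by
        simp [clip, Program.run, Test.eval, RealExp.eval, ← ha, ← hb, ← hlo, h, h']
      rw [e]
      refine ⟨fun t => ?_, f0 _⟩
      simp only [State.Has, State.putReal_realReg, if_true, key, ← hlo, ← hhi]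
      simp only [one_ne_zero, if_false]
      exact ⟨fun ⟨h1, h2⟩ => ⟨⟨h'.le.trans h1, h2⟩, h1⟩, fun ⟨h1, h2⟩ => ⟨h2, h1.2⟩⟩
    · have e : clip.run s = s := by
        simp [clip, Program.run, Test.eval, RealExp.eval, ← ha, ← hb, ← hlo, h, h']
      rw [e]
      refine ⟨fun t => ?_, f⟩
      rw [key]
      exact ⟨fun h1 => ⟨h1, (not_lt.mp h').trans h1.1⟩, fun h1 => h1.1⟩

/-- Clip by the inequality `0 ≤ σ * ⟨z, (1 - t, t)⟩`, where `z` is in the real registers `i` and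
`i + 1`. -/
def clipX (σ : ℤ) (i : ℕ) : Program :=
  .seq (.setReal 2 (.mul (.const σ) (.reg i)))
    (.seq (.setReal 3 (.mul (.const σ) (.sub (.reg (i + 1)) (.reg i)))) clip)

/-- Clip by the inequality `0 ≤ σ * ⟨z, (-t, 1 - t)⟩`, where `z` is in the real registers `i` and
`i + 1`. -/
def clipY (σ : ℤ) (i : ℕ) : Program :=
  .seq (.setReal 2 (.mul (.const σ) (.reg (i + 1))))
    (.seq (.setReal 3 (.mul (.const (-σ)) (.add (.reg i) (.reg (i + 1))))) clip)

theorem clip_put_spec (s : State) (a b : ℝ) :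
    (∀ t, (clip.run ((s.putReal 2 a).putReal 3 b)).Has t ↔ s.Has t ∧ 0 ≤ a + b * t) ∧
      RealFrame s (clip.run ((s.putReal 2 a).putReal 3 b)) := by
  obtain ⟨h1, h2⟩ := clip_spec ((s.putReal 2 a).putReal 3 b)
  refine ⟨fun t => by rw [h1]; simp [State.Has],
    RealFrame.trans (s' := (s.putReal 2 a).putReal 3 b) ⟨rfl, rfl, rfl, ?_⟩ h2⟩
  intro x hx
  have h2 : x ≠ 2 := by omega
  have h3 : x ≠ 3 := by omega
  simp [h2, h3]

/-- The bound `4 ≤ i` protects the vector from the registers overwritten by clipping. -/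
theorem clipX_spec (s : State) (σ : ℤ) {i : ℕ} (hi : 4 ≤ i) {x y : ℝ} (hx : s.realReg i = x)
    (hy : s.realReg (i + 1) = y) :
    (∀ t, ((clipX σ i).run s).Has t ↔ s.Has t ∧ 0 ≤ σ * (x * (1 - t) + y * t)) ∧
      RealFrame s ((clipX σ i).run s) := by
  have h2 : i ≠ 2 := by omega
  have h3 : i ≠ 1 := by omega
  have e : (clipX σ i).run s = clip.run ((s.putReal 2 (σ * x)).putReal 3 (σ * (y - x))) := by
    simp [clipX, Program.run, RealExp.eval, hx, hy, h2, h3]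
  rw [e]
  obtain ⟨h1, h2⟩ := clip_put_spec s (σ * x) (σ * (y - x))
  refine ⟨fun t => ?_, h2⟩
  rw [h1, show (σ : ℝ) * x + σ * (y - x) * t = σ * (x * (1 - t) + y * t) by ring]

theorem clipY_spec (s : State) (σ : ℤ) {i : ℕ} (hi : 4 ≤ i) {x y : ℝ} (hx : s.realReg i = x)
    (hy : s.realReg (i + 1) = y) :
    (∀ t, ((clipY σ i).run s).Has t ↔ s.Has t ∧ 0 ≤ σ * (y * (1 - t) - x * t)) ∧
      RealFrame s ((clipY σ i).run s) := by
  have h2 : i ≠ 2 := by omega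
  have h3 : i ≠ 1 := by omega
  have e : (clipY σ i).run s = clip.run ((s.putReal 2 (σ * y)).putReal 3 (-σ * (x + y))) := by
    simp [clipY, Program.run, RealExp.eval, hx, hy, h2, h3]
  rw [e]
  obtain ⟨h1, h2⟩ := clip_put_spec s (σ * y) (-σ * (x + y))
  refine ⟨fun t => ?_, h2⟩
  rw [h1, show (σ : ℝ) * y + -σ * (x + y) * t = σ * (y * (1 - t) - x * t) by ring]

/-- With respect to the axes with directions `(1 - t, t)` and `(-t, 1 - t)`, both vectors
`(ax, ay)` and `(dx, dy)` lie in the closed quadrant with the signs `σ` and `τ`. -/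
structure InQuadrant (σ τ : ℤ) (ax ay dx dy t : ℝ) : Prop where
  nonneg : 0 ≤ t
  le_one : t ≤ 1
  fst_x : 0 ≤ σ * (ax * (1 - t) + ay * t)
  snd_x : 0 ≤ σ * (dx * (1 - t) + dy * t)
  fst_y : 0 ≤ τ * (ay * (1 - t) - ax * t)
  snd_y : 0 ≤ τ * (dy * (1 - t) - dx * t)

/-- Load the end points of edge `j`, and the vectors from the root to the second one and from there
to the first one. -/
def loadEdge (a b : ℕ) : Program :=
  .seq (.setNat 6 (.arr a (.reg 3)))
    (.seq (.setNat 7 (.arr b (.reg 3)))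
      (.seq (.setReal 4 (.sub (.arr 0 (.reg 7)) (.arr 0 (.reg 2))))
        (.seq (.setReal 5 (.sub (.arr 1 (.reg 7)) (.arr 1 (.reg 2))))
          (.seq (.setReal 6 (.sub (.arr 0 (.reg 6)) (.arr 0 (.reg 7))))
            (.seq (.setReal 7 (.sub (.arr 1 (.reg 6)) (.arr 1 (.reg 7))))
              (.seq (.setReal 0 (.const 0)) (.setReal 1 (.const 1))))))))

/-- Clip by the four inequalities for a quadrant. -/
def clipQuadrant (σ τ : ℤ) : Program :=
  .seq (clipX σ 4) (.seq (clipX σ 6) (.seq (clipY τ 4) (clipY τ 6)))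

/-- Store the interval; if it is empty, store an interval of the root instead. -/
def storeInterval : Program :=
  .seq (.ite (.realLt (.reg 1) (.reg 0))
      (.seq (.setNat 6 (.reg 2)) (.seq (.setReal 0 (.const 0)) (.setReal 1 (.const 1)))) .skip)
    (.seq (.setNatArr 2 (.reg 4) (.reg 6))
      (.seq (.setNatArr 2 (.add (.reg 5) (.reg 4)) (.reg 6))
        (.seq (.setRealArr 2 (.reg 4) (.reg 0))
          (.seq (.setRealArr 2 (.add (.reg 5) (.reg 4)) (.reg 1))
            (.setNat 4 (.add (.reg 4) (.const 1)))))))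

theorem clipQuadrant_spec (s : State) (σ τ : ℤ) (h0 : s.realReg 0 = 0) (h1 : s.realReg 1 = 1) :
    (∀ t, ((clipQuadrant σ τ).run s).Has t ↔
      InQuadrant σ τ (s.realReg 4) (s.realReg 5) (s.realReg 6) (s.realReg 7) t) ∧
      RealFrame s ((clipQuadrant σ τ).run s) := by
  obtain ⟨a1, f1⟩ := clipX_spec s σ (i := 4) le_rfl rfl rfl
  obtain ⟨a2, f2⟩ := clipX_spec ((clipX σ 4).run s) σ (i := 6) (by norm_num)
    (f1.realReg 6 (by norm_num)) (f1.realReg 7 (by norm_num))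
  have f2 := f1.trans f2
  obtain ⟨a3, f3⟩ := clipY_spec ((clipX σ 6).run ((clipX σ 4).run s)) τ (i := 4) le_rfl
    (f2.realReg 4 (by norm_num)) (f2.realReg 5 (by norm_num))
  have f3 := f2.trans f3
  obtain ⟨a4, f4⟩ := clipY_spec ((clipY τ 4).run ((clipX σ 6).run ((clipX σ 4).run s))) τ (i := 6)
    (by norm_num) (f3.realReg 6 (by norm_num)) (f3.realReg 7 (by norm_num))
  refine ⟨fun t => ?_, f3.trans f4⟩
  have e : (clipQuadrant σ τ).run s =
    (clipY τ 6).run ((clipY τ 4).run ((clipX σ 6).run ((clipX σ 4).run s))) := rfl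
  rw [e, a4, a3, a2, a1, State.Has, h0, h1]
  exact ⟨fun ⟨⟨⟨⟨⟨b1, b2⟩, b3⟩, b4⟩, b5⟩, b6⟩ => ⟨b1, b2, b3, b4, b5, b6⟩,
    fun ⟨b1, b2, b3, b4, b5, b6⟩ => ⟨⟨⟨⟨⟨b1, b2⟩, b3⟩, b4⟩, b5⟩, b6⟩⟩

/-- Replacing an empty interval by `[0, 1]` for the root is harmless, as the root needs no cover.
Every call then stores exactly one nonempty interval, so the total is known in advance and the ends
can be stored at a fixed offset. -/
theorem storeInterval_spec (s : State) :
    ∃ v lo hi, (s.realReg 1 < s.realReg 0 ∧ v = s.natReg 2 ∧ lo = 0 ∧ hi = 1 ∨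
      s.realReg 0 ≤ s.realReg 1 ∧ v = s.natReg 6 ∧ lo = s.realReg 0 ∧ hi = s.realReg 1) ∧
    (storeInterval.run s).natArr 2 = Function.update (Function.update (s.natArr 2) (s.natReg 4) v)
      (s.natReg 5 + s.natReg 4) v ∧
    (storeInterval.run s).realArr 2 = Function.update
      (Function.update (s.realArr 2) (s.natReg 4) lo) (s.natReg 5 + s.natReg 4) hi ∧
    (storeInterval.run s).natReg 4 = s.natReg 4 + 1 ∧
    (∀ x, x ∉ [4, 6] → (storeInterval.run s).natReg x = s.natReg x) ∧
    (∀ a, a ≠ 2 → (storeInterval.run s).natArr a = s.natArr a) ∧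
    (∀ a, a ≠ 2 → (storeInterval.run s).realArr a = s.realArr a) := by
  by_cases h : s.realReg 1 < s.realReg 0
  · refine ⟨s.natReg 2, 0, 1, .inl ⟨h, rfl, rfl, rfl⟩, ?_, ?_, ?_, fun x hx => ?_, fun a ha => ?_,
      fun a ha => ?_⟩
    · simp [storeInterval, Program.run, Test.eval, NatExp.eval, RealExp.eval, h]
    · simp [storeInterval, Program.run, Test.eval, NatExp.eval, RealExp.eval, h]
    · simp [storeInterval, Program.run, Test.eval, NatExp.eval, RealExp.eval, h]
    · simp only [List.mem_cons, List.not_mem_nil, or_false, not_or] at hx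
      simp [storeInterval, Program.run, Test.eval, NatExp.eval, RealExp.eval, h, hx]
    · simp [storeInterval, Program.run, Test.eval, NatExp.eval, RealExp.eval, h, ha]
    · simp [storeInterval, Program.run, Test.eval, NatExp.eval, RealExp.eval, h, ha]
  · refine ⟨s.natReg 6, s.realReg 0, s.realReg 1, .inr ⟨not_lt.mp h, rfl, rfl, rfl⟩, ?_, ?_, ?_,
      fun x hx => ?_, fun a ha => ?_, fun a ha => ?_⟩
    · simp [storeInterval, Program.run, Test.eval, NatExp.eval, RealExp.eval, h]
    · simp [storeInterval, Program.run, Test.eval, NatExp.eval, RealExp.eval, h]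
    · simp [storeInterval, Program.run, Test.eval, NatExp.eval, RealExp.eval, h]
    · simp only [List.mem_cons, List.not_mem_nil, or_false, not_or] at hx
      simp [storeInterval, Program.run, Test.eval, NatExp.eval, RealExp.eval, h, hx]
    · simp [storeInterval, Program.run, Test.eval, NatExp.eval, RealExp.eval, h, ha]
    · simp [storeInterval, Program.run, Test.eval, NatExp.eval, RealExp.eval, h, ha]

/-- Compute and store the interval of an edge for a direction of the edge and a quadrant. -/
def emit (a b : ℕ) (σ τ : ℤ) : Program :=
  .seq (loadEdge a b) (.seq (clipQuadrant σ τ) storeInterval)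

/-- The set of `t` that edge `j`, directed from its end point in array `b` to the one in array `a`,
admits for a quadrant. -/
def Admits (s : State) (j a b : ℕ) (σ τ : ℤ) (t : ℝ) : Prop :=
  InQuadrant σ τ
    (s.realArr 0 (s.natArr b j) - s.realArr 0 (s.natReg 2))
    (s.realArr 1 (s.natArr b j) - s.realArr 1 (s.natReg 2))
    (s.realArr 0 (s.natArr a j) - s.realArr 0 (s.natArr b j))
    (s.realArr 1 (s.natArr a j) - s.realArr 1 (s.natArr b j)) t

/-! ### The list of all intervals. -/

/-- In the computation started in `s₀`, `m` intervals have been stored, and they cover `t` for `v`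
when `Φ v t` holds. -/
structure Emitted (s₀ : State) (m : ℕ) (Φ : ℕ → ℝ → Prop) (s : State) : Prop where
  natReg : ∀ x, x ∉ [3, 4, 6, 7] → s.natReg x = s₀.natReg x
  natArr : ∀ a, a ≠ 2 → s.natArr a = s₀.natArr a
  realArr : ∀ a, a ≠ 2 → s.realArr a = s₀.realArr a
  reg4 : s.natReg 4 = m
  intervals : ∀ i < m, s.natArr 2 i < s₀.natReg 0 ∧
    s.natArr 2 (s₀.natReg 5 + i) = s.natArr 2 i ∧ 0 ≤ s.realArr 2 i ∧
    s.realArr 2 i ≤ s.realArr 2 (s₀.natReg 5 + i) ∧ s.realArr 2 (s₀.natReg 5 + i) ≤ 1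
  covers : ∀ v ≠ s₀.natReg 2, ∀ t, (∃ i < m, s.natArr 2 i = v ∧ s.realArr 2 i ≤ t ∧
    t ≤ s.realArr 2 (s₀.natReg 5 + i)) ↔ Φ v t

theorem Emitted.emit {s₀ s : State} {m a b j : ℕ} {Φ : ℕ → ℝ → Prop} (h : Emitted s₀ m Φ s)
    (ha : a ≠ 2) (hb : b ≠ 2) (σ τ : ℤ) (hm : m < s₀.natReg 5) (hj : s.natReg 3 = j)
    (hr : s₀.natReg 2 < s₀.natReg 0) (hv : s₀.natArr a j < s₀.natReg 0) :
    Emitted s₀ (m + 1) (fun v t => Φ v t ∨ v = s₀.natArr a j ∧ Admits s₀ j a b σ τ t)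
      ((emit a b σ τ).run s) ∧ ((emit a b σ τ).run s).natReg 3 = j := by
  have r2 := h.natReg 2 (by decide)
  have r5 := h.natReg 5 (by decide)
  set u := (loadEdge a b).run s with hu
  have u4 : u.natReg 4 = s.natReg 4 := by simp [hu, loadEdge, Program.run]
  have uX : ∀ x, x ∉ [3, 4, 6, 7] → u.natReg x = s.natReg x := by
    intro x hx
    simp only [List.mem_cons, List.not_mem_nil, or_false, not_or] at hx
    simp [hu, loadEdge, Program.run, hx]
  have u3 : u.natReg 3 = j := by simp [hu, loadEdge, Program.run, hj]
  have u6 : u.natReg 6 = s₀.natArr a j := by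
    simp [hu, loadEdge, Program.run, NatExp.eval, hj, h.natArr a ha]
  have uA : u.natArr = s.natArr := by simp [hu, loadEdge, Program.run]
  have uR : u.realArr = s.realArr := by simp [hu, loadEdge, Program.run]
  obtain ⟨c1, c2⟩ := clipQuadrant_spec u σ τ (by simp [hu, loadEdge, Program.run, RealExp.eval])
    (by simp [hu, loadEdge, Program.run, RealExp.eval])
  have c1 : ∀ t, ((clipQuadrant σ τ).run u).Has t ↔ Admits s₀ j a b σ τ t := by
    intro t
    rw [c1]
    simp [hu, loadEdge, Program.run, RealExp.eval, NatExp.eval, hj, h.natArr a ha, h.natArr b hb,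
      h.realArr 0, h.realArr 1, r2, Admits]
  have e : (RealRAM.emit a b σ τ).run s = storeInterval.run ((clipQuadrant σ τ).run u) := rfl
  rw [e]
  obtain ⟨v, lo, hi, d1, d2, d3, d4, d5, d6, d7⟩ := storeInterval_spec ((clipQuadrant σ τ).run u)
  simp only [c2.natReg, c2.natArr, c2.realArr, uA, uR, u4, u6, uX 5 (by decide),
    uX 2 (by decide), r2, r5, h.reg4] at d1 d2 d3 d4 d5 d6 d7
  have dX : ∀ x, x ∉ [3, 4, 6, 7] →
      (storeInterval.run ((clipQuadrant σ τ).run u)).natReg x = s₀.natReg x := by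
    intro x hx
    have hx' := hx
    simp only [List.mem_cons, List.not_mem_nil, or_false, not_or] at hx'
    rw [d5 x (by simp [hx']), uX x hx, h.natReg x hx]
  have V1 : ∀ i < m, (storeInterval.run ((clipQuadrant σ τ).run u)).natArr 2 i =
      s.natArr 2 i := by
    intro i hi
    rw [d2, Function.update_of_ne (by omega), Function.update_of_ne (by omega)]
  have V2 : ∀ i < m, (storeInterval.run ((clipQuadrant σ τ).run u)).natArr 2
      (s₀.natReg 5 + i) = s.natArr 2 (s₀.natReg 5 + i) := by
    intro i hi
    rw [d2, Function.update_of_ne (by omega), Function.update_of_ne (by omega)]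
  have V3 : (storeInterval.run ((clipQuadrant σ τ).run u)).natArr 2 m = v := by
    rw [d2, Function.update_of_ne (by omega), Function.update_self]
  have V4 : (storeInterval.run ((clipQuadrant σ τ).run u)).natArr 2 (s₀.natReg 5 + m) = v := by
    rw [d2, Function.update_self]
  have K1 : ∀ i < m, (storeInterval.run ((clipQuadrant σ τ).run u)).realArr 2 i =
      s.realArr 2 i := by
    intro i hi
    rw [d3, Function.update_of_ne (by omega), Function.update_of_ne (by omega)]
  have K2 : ∀ i < m, (storeInterval.run ((clipQuadrant σ τ).run u)).realArr 2
      (s₀.natReg 5 + i) = s.realArr 2 (s₀.natReg 5 + i) := by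
    intro i hi
    rw [d3, Function.update_of_ne (by omega), Function.update_of_ne (by omega)]
  have K3 : (storeInterval.run ((clipQuadrant σ τ).run u)).realArr 2 m = lo := by
    rw [d3, Function.update_of_ne (by omega), Function.update_self]
  have K4 : (storeInterval.run ((clipQuadrant σ τ).run u)).realArr 2 (s₀.natReg 5 + m) = hi := by
    rw [d3, Function.update_self]
  have hnew : v < s₀.natReg 0 ∧ 0 ≤ lo ∧ lo ≤ hi ∧ hi ≤ 1 ∧ (∀ w ≠ s₀.natReg 2, ∀ t,
      (v = w ∧ lo ≤ t ∧ t ≤ hi) ↔ w = s₀.natArr a j ∧ Admits s₀ j a b σ τ t) := by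
    rcases d1 with ⟨g1, rfl, rfl, rfl⟩ | ⟨g1, rfl, rfl, rfl⟩
    · refine ⟨hr, le_rfl, zero_le_one, le_rfl, fun w hw t => ?_⟩
      rw [← c1]
      constructor
      · rintro ⟨rfl, -⟩
        exact absurd rfl hw
      · rintro ⟨-, g2, g3⟩
        exact absurd (g2.trans g3) (not_le.mpr g1)
    -- A nonempty interval contains both its ends, so these satisfy the inequalities themselves and
    -- lie in `[0, 1]`.
    · have g2 := (c1 _).mp ⟨le_rfl, g1⟩
      have g3 := (c1 _).mp ⟨g1, le_rfl⟩
      refine ⟨hv, g2.nonneg, g1, g3.le_one, fun w hw t => ?_⟩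
      rw [← c1, eq_comm (a := w)]
      rfl
  refine ⟨⟨dX, fun x hx => by rw [d6 x hx, h.natArr x hx],
    fun x hx => by rw [d7 x hx, h.realArr x hx], d4, fun i hi => ?_, fun w hw t => ?_⟩,
    by rw [d5 3 (by decide), u3]⟩
  · rcases (Nat.lt_succ_iff.mp hi).lt_or_eq with hi | rfl
    · rw [V1 i hi, V2 i hi, K1 i hi, K2 i hi]
      exact h.intervals i hi
    · rw [V3, V4, K3, K4]
      exact ⟨hnew.1, rfl, hnew.2.1, hnew.2.2.1, hnew.2.2.2.1⟩
  · rw [← h.covers w hw t, ← hnew.2.2.2.2 w hw t]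
    constructor
    · rintro ⟨i, hi, g⟩
      rcases (Nat.lt_succ_iff.mp hi).lt_or_eq with hi | rfl
      · rw [V1 i hi, K1 i hi, K2 i hi] at g
        exact .inl ⟨i, hi, g⟩
      · rw [V3, K3, K4] at g
        exact .inr g
    · rintro (⟨i, hi, g⟩ | g)
      · exact ⟨i, by omega, by rwa [V1 i hi, K1 i hi, K2 i hi]⟩
      · exact ⟨m, by omega, by rwa [V3, K3, K4]⟩

/-- The two directions of an edge and the four quadrants. -/
def cases : List (ℕ × ℕ × ℤ × ℤ) :=
  [(0, 1, 1, 1), (0, 1, 1, -1), (0, 1, -1, 1), (0, 1, -1, -1),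
    (1, 0, 1, 1), (1, 0, 1, -1), (1, 0, -1, 1), (1, 0, -1, -1)]

/-- Apply `emit` for all elements of the list. -/
def emitList : List (ℕ × ℕ × ℤ × ℤ) → Program
  | [] => .skip
  | c :: l => .seq (emit c.1 c.2.1 c.2.2.1 c.2.2.2) (emitList l)

theorem Emitted.emitList {s₀ : State} {j : ℕ} (hr : s₀.natReg 2 < s₀.natReg 0)
    (l : List (ℕ × ℕ × ℤ × ℤ))
    (hl : ∀ c ∈ l, c.1 ≠ 2 ∧ c.2.1 ≠ 2 ∧ s₀.natArr c.1 j < s₀.natReg 0)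
    {s : State} {m : ℕ} {Φ : ℕ → ℝ → Prop} (h : Emitted s₀ m Φ s)
    (hm : m + l.length ≤ s₀.natReg 5) (hj : s.natReg 3 = j) :
    Emitted s₀ (m + l.length) (fun v t => Φ v t ∨ ∃ c ∈ l, v = s₀.natArr c.1 j ∧
      Admits s₀ j c.1 c.2.1 c.2.2.1 c.2.2.2 t) ((emitList l).run s) ∧
      ((emitList l).run s).natReg 3 = j := by
  induction l generalizing s m Φ with
  | nil => exact ⟨by simpa [RealRAM.emitList, Program.run] using h, hj⟩
  | cons c l ih =>
    rw [List.length_cons] at hm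
    have hc := hl c (by simp)
    obtain ⟨h1, h2⟩ := h.emit hc.1 hc.2.1 c.2.2.1 c.2.2.2 (by omega) hj hr hc.2.2
    obtain ⟨h3, h4⟩ := ih (fun c hc => hl c (by simp [hc])) h1 (by omega) h2
    refine ⟨?_, h4⟩
    rw [List.length_cons, add_comm l.length 1, ← add_assoc]
    simpa only [List.exists_mem_cons_iff, or_assoc, RealRAM.emitList, Program.run] using h3

/-- Compute and store all intervals of edge `j`, and increase `j`. -/
def edgeStep : Program := .seq (emitList cases) (.setNat 3 (.add (.reg 3) (.const 1)))

/-- Compute and store all intervals. -/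
def collect : Program :=
  .seq (.seq (.setNat 5 (.add (.reg 1) (.reg 1)))
      (.seq (.setNat 5 (.add (.reg 5) (.reg 5))) (.setNat 5 (.add (.reg 5) (.reg 5)))))
    (.loop (.natLt (.reg 3) (.reg 1)) edgeStep)

theorem collect_runs {s : State} {p r E : ℕ} (hr : r < p) (h0 : s.natReg 0 = p)
    (h1 : s.natReg 1 = E) (h2 : s.natReg 2 = r) (h3 : s.natReg 3 = 0) (h4 : s.natReg 4 = 0)
    (hV : ∀ j < E, s.natArr 0 j < p ∧ s.natArr 1 j < p) :
    Runs collect s (12 + (E * (edgeStep.bound + 3) + 3)) (fun s' =>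
      s'.natReg 0 = p ∧ s'.natReg 2 = r ∧ s'.natReg 5 = 8 * E ∧
      s'.natReg 14 = s.natReg 14 ∧ s'.natArr 5 = s.natArr 5 ∧
      Intervals p (8 * E) (s'.natArr 2) (s'.realArr 2) ∧
      ∀ v ≠ r, ∀ t, Covers (8 * E) (s'.natArr 2) (s'.realArr 2) v t ↔
        ∃ j < E, ∃ c ∈ cases, v = s.natArr c.1 j ∧
          Admits s j c.1 c.2.1 c.2.2.1 c.2.2.2 t) := by
  -- Three doublings produce `8 * E`, since natural numbers can only be added and subtracted.
  refine Runs.seq (Runs.of_run (c := .seq (.setNat 5 (.add (.reg 1) (.reg 1)))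
      (.seq (.setNat 5 (.add (.reg 5) (.reg 5))) (.setNat 5 (.add (.reg 5) (.reg 5)))))
      (Q := fun s' => s'.natReg 5 = 8 * E ∧ (∀ x, x ≠ 5 → s'.natReg x = s.natReg x) ∧
        s'.natArr = s.natArr ∧ s'.realArr = s.realArr) ?_) ?_
  · refine ⟨?_, fun x hx => ?_, rfl, rfl⟩
    · simp [Program.run, NatExp.eval, h1]
      ring
    · simp [Program.run, hx]
  rintro u ⟨u5, uX, uA, uR⟩
  have u0 : u.natReg 0 = p := by rw [uX 0 (by decide), h0]
  have u1 : u.natReg 1 = E := by rw [uX 1 (by decide), h1]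
  have u2 : u.natReg 2 = r := by rw [uX 2 (by decide), h2]
  have hadm : ∀ j a b σ τ t, Admits u j a b σ τ t ↔ Admits s j a b σ τ t := by
    intro j a b σ τ t
    rw [Admits, Admits, uA, uR, uX 2 (by decide)]
  refine (Runs.loop (fun n s' => s'.natReg 3 + n = E ∧ Emitted u (8 * s'.natReg 3)
    (fun v t => ∃ j < s'.natReg 3, ∃ c ∈ cases, v = u.natArr c.1 j ∧
      Admits u j c.1 c.2.1 c.2.2.1 c.2.2.2 t) s') ?_ (n := E) ?_).mono le_rfl ?_
  · rintro n s' ⟨h5, h6⟩ h7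
    have h7 : s'.natReg 3 < s'.natReg 1 := h7
    rw [h6.natReg 1 (by decide), u1] at h7
    obtain ⟨n, rfl⟩ : ∃ n', n = n' + 1 := ⟨n - 1, by omega⟩
    refine ⟨n, rfl, Runs.of_run (c := edgeStep) ?_⟩
    have hj := hV _ h7
    have hc : ∀ c ∈ cases, c.1 ≠ 2 ∧ c.2.1 ≠ 2 ∧ u.natArr c.1 (s'.natReg 3) < u.natReg 0 := by
      simp [cases, uA, u0, hj]
    obtain ⟨h8, h9⟩ := h6.emitList (by rw [u0, u2]; exact hr) cases hc
      (by rw [u5]; simp only [cases, List.length_cons, List.length_nil]; omega) rfl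
    have e : edgeStep.run s' = ((emitList cases).run s').putNat 3 (s'.natReg 3 + 1) := by
      rw [← h9]; rfl
    have e3 : (edgeStep.run s').natReg 3 = s'.natReg 3 + 1 := by rw [e]; simp
    rw [e3]
    refine ⟨by omega, ?_⟩
    rw [e]
    refine ⟨fun x hx => ?_, h8.natArr, h8.realArr, ?_, ?_, fun v hv t => ?_⟩
    · rw [← h8.natReg x hx]
      simp only [List.mem_cons, List.not_mem_nil, or_false, not_or] at hx
      simp [hx]
    · rw [State.putNat_natReg, if_neg (by decide), h8.reg4]
      rfl
    · exact h8.intervals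
    · refine (h8.covers v hv t).trans ?_
      constructor
      · rintro (⟨j, hj, h⟩ | h)
        · exact ⟨j, by omega, h⟩
        · exact ⟨_, by omega, h⟩
      · rintro ⟨j, hj, h⟩
        rcases (Nat.lt_succ_iff.mp hj).lt_or_eq with hj | rfl
        · exact .inl ⟨j, hj, h⟩
        · exact .inr h
  · have u3 : u.natReg 3 = 0 := by rw [uX 3 (by decide), h3]
    have u4 : u.natReg 4 = 0 := by rw [uX 4 (by decide), h4]
    rw [u3]
    exact ⟨by omega, fun _ _ => rfl, fun _ _ => rfl, fun _ _ => rfl, u4, by simp, by simp⟩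
  · rintro s' ⟨⟨n, h5, h6⟩, h7⟩
    have h7 : ¬ s'.natReg 3 < s'.natReg 1 := h7
    rw [h6.natReg 1 (by decide), u1] at h7
    have e3 : s'.natReg 3 = E := by omega
    rw [e3] at h6
    have hi := h6.intervals
    have hcov := h6.covers
    rw [u0, u5] at hi
    rw [u2, u5] at hcov
    refine ⟨?_, ?_, ?_, ?_, ?_, ⟨fun i h => (hi i h).1, fun i h => (hi i h).2.1,
      fun i h => (hi i h).2.2.1, fun i h => (hi i h).2.2.2.1, fun i h => (hi i h).2.2.2.2⟩,
      fun v hv t => ?_⟩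
    · rw [h6.natReg 0 (by decide), u0]
    · rw [h6.natReg 2 (by decide), u2]
    · rw [h6.natReg 5 (by decide), u5]
    · rw [h6.natReg 14 (by decide), uX 14 (by decide)]
    · rw [h6.natArr 5 (by decide), uA]
    · have := hcov v hv t
      simp only [hadm, uA] at this
      exact this

end RealRAM

namespace Geom

variable {P : Finset Plane}

/-! ### Monotone paths -/

/-- Chains of a transitive relation are pairwise. The decreasing case is written with `-c`, so that
facts about increasing walks apply to both. -/
theorem monotoneSeq_support_iff {G : GeometricGraph P} {r p : P} (c : Plane → ℝ) (W : G.Walk r p) :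
    MonotoneSeq c (W.support.map (fun q => (q : Plane))) ↔
      W.support.Pairwise (fun x y : P => c x ≤ c y) ∨
        W.support.Pairwise (fun x y : P => -c x ≤ -c y) := by
  -- The cast in the statement is elaborated as a monadic coercion of the list, followed by an
  -- identity map.
  have h0 : List.map (fun q => (q : Plane)) (do let a ← W.support; pure (a : Plane)) =
      List.map (fun q : P => (q : Plane)) W.support := by
    rw [List.map_id', List.map_eq_flatMap]
    rfl
  have h1 : IsTrans Plane (fun x y => c x ≤ c y) := ⟨fun _ _ _ => le_trans⟩
  have h2 : IsTrans Plane (fun x y => c y ≤ c x) := ⟨fun _ _ _ h h' => h'.trans h⟩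
  rw [h0, MonotoneSeq, List.isChain_iff_pairwise, List.isChain_iff_pairwise, List.pairwise_map, List.pairwise_map]
  simp only [neg_le_neg_iff]

/-! ### Monotone walks and their extension by one edge. -/

section Walk

variable {V : Type*} {G : SimpleGraph V} {c : V → ℝ} {r p q : V}

theorem le_of_pairwise_support {W : G.Walk r p} (h : W.support.Pairwise (fun x y => c x ≤ c y))
    {w : V} (hw : w ∈ W.support) : c r ≤ c w ∧ c w ≤ c p := by
  constructor
  · rw [← W.cons_tail_support] at h hw
    rcases List.mem_cons.mp hw with rfl | hw
    · exact le_rfl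
    · exact List.rel_of_pairwise_cons h hw
  · rw [← W.dropLast_support_concat] at h hw
    rcases List.mem_append.mp hw with hw | hw
    · exact (List.pairwise_append.mp h).2.2 w hw p (by simp)
    · rw [List.mem_singleton.mp hw]

theorem pairwise_support_concat {W : G.Walk r q} (h : W.support.Pairwise (fun x y => c x ≤ c y))
    (hqp : G.Adj q p) (hle : c q ≤ c p) :
    (W.concat hqp).support.Pairwise (fun x y => c x ≤ c y) := by
  rw [SimpleGraph.Walk.support_concat, List.pairwise_append]
  refine ⟨h, List.pairwise_singleton _ _, fun a ha b hb => ?_⟩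
  rw [List.mem_singleton.mp hb]
  exact (le_of_pairwise_support h ha).2.trans hle

/-- A walk that is monotone in `c` may be continued by an edge that does not leave the
box spanned by its end points. -/
theorem monotone_support_concat {W : G.Walk r q} (h : W.support.Pairwise (fun x y => c x ≤ c y))
    (hqp : G.Adj q p) (hle : 0 ≤ (c q - c r) * (c p - c q)) :
    (W.concat hqp).support.Pairwise (fun x y => c x ≤ c y) ∨
      (W.concat hqp).support.Pairwise (fun x y => -c x ≤ -c y) := by
  rcases le_or_gt (c q) (c p) with h1 | h1
  · exact .inl (pairwise_support_concat h hqp h1)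
  -- If the new edge descends, the sign condition forces `c q ≤ c r`; an increasing walk is then
  -- constant in `c` and also counts as decreasing.
  · have h2 : c q ≤ c r := by
      by_contra! h2
      nlinarith [mul_pos (sub_pos.mpr h2) (sub_pos.mpr h1)]
    refine .inr (pairwise_support_concat (c := fun x => -c x) ?_ hqp (neg_le_neg h1.le))
    refine h.imp_of_mem fun ha hb _ => ?_
    have := le_of_pairwise_support h ha
    have := le_of_pairwise_support h hb
    linarith

end Walk

/-- A geometric graph is rooted `x'y'`-monotone if and only if every vertex other than the root has
a neighbour in the box spanned by it and the root. -/
theorem rootedXYMonotone_iff (b : CartesianSystem) (G : GeometricGraph P) (r : P) :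
    RootedXYMonotone b G r ↔ ∀ p ≠ r, ∃ q, G.Adj q p ∧
      ∀ k, 0 ≤ (coord b k q - coord b k r) * (coord b k p - coord b k q) := by
  constructor
  · intro h p hp
    obtain ⟨W, -, h0, h1⟩ := h p
    obtain ⟨q, W', hqp, rfl⟩ : ∃ (q : P) (W' : G.Walk r q) (hqp : G.Adj q p),
        W = W'.concat hqp := by
      cases W with
      | nil => exact absurd rfl hp
      | cons h W =>
        obtain ⟨q, W', hqp, e⟩ := W.exists_cons_eq_concat h
        exact ⟨q, W', hqp, e⟩
    refine ⟨q, hqp, ?_⟩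
    have key : ∀ c : P → ℝ, (W'.concat hqp).support.Pairwise (fun x y => c x ≤ c y) →
        0 ≤ (c q - c r) * (c p - c q) := by
      intro c hc
      have := le_of_pairwise_support hc (w := q) (by
        rw [SimpleGraph.Walk.support_concat]
        exact List.mem_append_left _ W'.end_mem_support)
      exact mul_nonneg (sub_nonneg.mpr this.1) (sub_nonneg.mpr this.2)
    have key' : ∀ k, MonotoneSeq (coord b k)
        ((W'.concat hqp).support.map (fun q => (q : Plane))) →
        0 ≤ (coord b k q - coord b k r) * (coord b k p - coord b k q) := by
      intro k hk
      rcases (monotoneSeq_support_iff _ _).mp hk with h | h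
      · exact key (fun x => coord b k x) h
      · have := key (fun x => -coord b k x) h
        linarith
    exact Fin.forall_fin_two.mpr ⟨key' 0 h0, key' 1 h1⟩
  · intro h
    -- Induction on the ℓ¹ distance to the root, measured along the axes.
    set f : P → ℝ := fun p => ∑ k, |coord b k p - coord b k r| with hf
    have : IsTrans P (fun q p => f q < f p) := ⟨fun _ _ _ => lt_trans⟩
    have : Std.Irrefl (fun q p : P => f q < f p) := ⟨fun _ => lt_irrefl _⟩
    have wf : WellFounded (fun q p : P => f q < f p) := Finite.wellFounded_of_trans_of_irrefl _
    intro p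
    induction p using wf.induction with
    | _ p ih =>
    by_cases hp : p = r
    · subst hp
      exact ⟨.nil, .nil, by simp [XYMonotoneSeq, MonotoneSeq]⟩
    obtain ⟨q, hqp, hq⟩ := h p hp
    have split : ∀ k, |coord b k p - coord b k r| =
        |coord b k q - coord b k r| + |coord b k p - coord b k q| := by
      intro k
      have e : coord b k p - coord b k r =
        (coord b k q - coord b k r) + (coord b k p - coord b k q) := by ring
      -- Absolute values add up exactly when the summands have a common sign, which is the box
      -- condition.
      rw [e, abs_add_eq_add_abs_iff]
      exact mul_nonneg_iff.mp (hq k)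
    have hlt : f q < f p := by
      have h1 : f p = f q + ∑ k, |coord b k p - coord b k q| := by
        rw [hf]
        simp only [split, Finset.sum_add_distrib]
      rw [h1, lt_add_iff_pos_right]
      refine (Finset.sum_nonneg fun _ _ => abs_nonneg _).lt_of_ne fun h0 => hqp.ne ?_
      rw [eq_comm, Finset.sum_eq_zero_iff_of_nonneg fun _ _ => abs_nonneg _] at h0
      refine Subtype.ext (b.repr.injective (PiLp.ext fun k => ?_))
      have := abs_eq_zero.mp (h0 k (Finset.mem_univ _))
      exact (sub_eq_zero.mp this).symm
    obtain ⟨W, hW, hm⟩ := ih q hlt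
    have hm' : ∀ k, MonotoneSeq (coord b k) (W.support.map (fun q => (q : Plane))) :=
      Fin.forall_fin_two.mpr hm
    -- By monotonicity all vertices of `W` are at most as far from the root as `q`, and `p` is
    -- farther; so the extended walk is a path.
    have hnot : p ∉ W.support := by
      intro hpW
      refine hlt.not_ge (Finset.sum_le_sum fun k _ => ?_)
      rcases (monotoneSeq_support_iff _ _).mp (hm' k) with h | h
      · obtain ⟨h1, h2⟩ := le_of_pairwise_support (c := fun x : P => coord b k x) h hpW
        rw [abs_of_nonneg (by linarith), abs_of_nonneg (by linarith)]
        linarith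
      · obtain ⟨h1, h2⟩ := le_of_pairwise_support (c := fun x : P => -coord b k x) h hpW
        rw [abs_of_nonpos (by linarith), abs_of_nonpos (by linarith)]
        linarith
    have hfin : ∀ k, MonotoneSeq (coord b k)
        ((W.concat hqp).support.map (fun q => (q : Plane))) := by
      intro k
      rw [monotoneSeq_support_iff]
      rcases (monotoneSeq_support_iff _ _).mp (hm' k) with h | h
      · exact monotone_support_concat (c := fun x : P => coord b k x) h hqp (hq k)
      · have := monotone_support_concat (c := fun x : P => -coord b k x) h hqp (by
          have := hq k
          linarith)
        simpa only [neg_neg] using this.symm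
    exact ⟨W.concat hqp, hW.concat hnot hqp, hfin 0, hfin 1⟩

/-! ### Cartesian systems -/

/-- With respect to the axes with directions `(1 - t, t)` and `(-t, 1 - t)`, the vectors `a` and `d`
lie in a common closed quadrant. -/
def SameQuadrant (t : ℝ) (a d : Plane) : Prop :=
  0 ≤ (a 0 * (1 - t) + a 1 * t) * (d 0 * (1 - t) + d 1 * t) ∧
    0 ≤ (a 1 * (1 - t) - a 0 * t) * (d 1 * (1 - t) - d 0 * t)

theorem coord_eq (b : CartesianSystem) (k : Fin 2) (p : Plane) :
    coord b k p = b k 0 * p 0 + b k 1 * p 1 := by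
  rw [coord, b.repr_apply_apply, PiLp.inner_apply, Fin.sum_univ_two]
  simp [mul_comm]

theorem coord_sub (b : CartesianSystem) (k : Fin 2) (p q : Plane) :
    coord b k (p - q) = coord b k p - coord b k q := by
  simp [coord]

theorem orthonormal_coords (b : CartesianSystem) :
    b 0 0 ^ 2 + b 0 1 ^ 2 = 1 ∧ b 1 0 ^ 2 + b 1 1 ^ 2 = 1 ∧
      b 0 0 * b 1 0 + b 0 1 * b 1 1 = 0 := by
  have h0 := coord_eq b 0 (b 0)
  have h1 := coord_eq b 1 (b 1)
  have h2 := coord_eq b 0 (b 1)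
  simp only [coord, OrthonormalBasis.repr_self] at h0 h1 h2
  simp at h0 h1 h2
  exact ⟨by linarith, by linarith, by linarith⟩

theorem nonneg_iff_of_sq_mul {s x y : ℝ} (hs : s ≠ 0) (h : y = s ^ 2 * x) : 0 ≤ y ↔ 0 ≤ x := by
  rw [h, mul_nonneg_iff_of_pos_left (by positivity)]

/-- Let `(x, y)` be the first axis. If `x * y ≥ 0`, it is a multiple of `(1 - t, t)` with `t = y /
(x + y)`. Otherwise it is a multiple of `(-t, 1 - t)` with `t = x / (x - y)`, and the axes exchange
roles. Each product is only multiplied by the square of the scaling factor, so signs survive. -/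
theorem exists_param (b : CartesianSystem) : ∃ t, 0 ≤ t ∧ t ≤ 1 ∧ ∀ a d : Plane,
    (∀ k, 0 ≤ coord b k a * coord b k d) ↔ SameQuadrant t a d := by
  obtain ⟨h0, h1, h2⟩ := orthonormal_coords b
  simp only [Fin.forall_fin_two, coord_eq]
  generalize b 0 0 = x at *
  generalize b 0 1 = y at *
  generalize b 1 0 = x' at *
  generalize b 1 1 = y' at *
  -- The second axis is the first one turned by a right angle, up to the orientation `e = ±1`, the
  -- determinant of the system.
  obtain ⟨e, rfl, rfl⟩ : ∃ e, x' = -(e * y) ∧ y' = e * x :=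
    ⟨x * y' - y * x', by linear_combination x * h2 - x' * h0,
      by linear_combination y * h2 - y' * h0⟩
  have he : e ^ 2 = 1 := by linear_combination h1 - e ^ 2 * h0
  have hkey : ∀ a d : Plane, (-(e * y) * a 0 + e * x * a 1) * (-(e * y) * d 0 + e * x * d 1) =
      (x * a 1 - y * a 0) * (x * d 1 - y * d 0) := fun a d => by
    linear_combination (x * a 1 - y * a 0) * (x * d 1 - y * d 0) * he
  simp only [hkey]
  rcases le_or_gt 0 (x * y) with hxy | hxy
  · have hs : 0 < (x + y) ^ 2 := by nlinarith
    have hs0 : x + y ≠ 0 := fun h => by simp [h] at hs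
    obtain ⟨t, ht⟩ : ∃ t, y = t * (x + y) := ⟨y / (x + y), by field_simp⟩
    have ht' : x = (1 - t) * (x + y) := by linarith
    generalize x + y = s at *
    subst ht ht'
    refine ⟨t, ?_, ?_, fun a d => and_congr (nonneg_iff_of_sq_mul hs0 (by ring))
      (nonneg_iff_of_sq_mul hs0 (by ring))⟩
    · have : 0 ≤ t * s ^ 2 := by nlinarith [sq_nonneg (t * s)]
      exact nonneg_of_mul_nonneg_left this hs
    · have : 0 ≤ (1 - t) * s ^ 2 := by nlinarith [sq_nonneg ((1 - t) * s)]
      linarith [nonneg_of_mul_nonneg_left this hs]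
  · have hs : 0 < (x - y) ^ 2 := by nlinarith
    have hs0 : x - y ≠ 0 := fun h => by simp [h] at hs
    obtain ⟨t, ht⟩ : ∃ t, x = t * (x - y) := ⟨x / (x - y), by field_simp⟩
    have ht' : y = -(1 - t) * (x - y) := by linarith
    generalize x - y = s at *
    subst ht ht'
    refine ⟨t, ?_, ?_, fun a d => and_comm.trans (and_congr (nonneg_iff_of_sq_mul hs0 (by ring))
      (nonneg_iff_of_sq_mul hs0 (by ring)))⟩
    · have : 0 ≤ t * s ^ 2 := by nlinarith [sq_nonneg (t * s)]
      exact nonneg_of_mul_nonneg_left this hs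
    · have : 0 ≤ (1 - t) * s ^ 2 := by nlinarith [sq_nonneg ((1 - t) * s)]
      linarith [nonneg_of_mul_nonneg_left this hs]

/-- The vectors `(1 - t, t)` and `(-t, 1 - t)` are orthogonal, of equal nonzero length `n`; dividing
by `n` does not affect the signs of products. -/
theorem exists_system (t : ℝ) : ∃ b : CartesianSystem, ∀ a d : Plane,
    (∀ k, 0 ≤ coord b k a * coord b k d) ↔ SameQuadrant t a d := by
  have hpos : 0 < (1 - t) ^ 2 + t ^ 2 := by nlinarith [sq_nonneg (1 - t), sq_nonneg t]
  set n := Real.sqrt ((1 - t) ^ 2 + t ^ 2) with hn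
  have hn0 : n ≠ 0 := (Real.sqrt_pos.mpr hpos).ne'
  have hn2 : n ^ 2 = (1 - t) ^ 2 + t ^ 2 := Real.sq_sqrt hpos.le
  set v : Fin 2 → Plane := ![!₂[(1 - t) / n, t / n], !₂[-t / n, (1 - t) / n]] with hv
  have hinner : ∀ x y x' y' : ℝ, inner ℝ (!₂[x, y] : Plane) !₂[x', y'] = x * x' + y * y' := by
    intro x y x' y'
    rw [PiLp.inner_apply, Fin.sum_univ_two]
    simp [mul_comm]
  -- Restricting to the whole index set lets the extension lemma return a basis with both vectors
  -- prescribed.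
  have horth : Orthonormal ℝ (Set.univ.domRestrict v) := by
    refine Orthonormal.comp (v := v) ?_ _ Subtype.val_injective
    rw [orthonormal_iff_ite]
    have h1 : (1 - t) / n * ((1 - t) / n) + t / n * (t / n) = 1 := by
      field_simp
      exact hn2.symm
    intro i j
    fin_cases i <;> fin_cases j
    · exact (hinner _ _ _ _).trans h1
    · exact (hinner _ _ _ _).trans (by simp; ring)
    · exact (hinner _ _ _ _).trans (by simp; ring)
    · exact (hinner _ _ _ _).trans ((by ring : _ = _).trans h1)
  obtain ⟨b, hb⟩ := horth.exists_orthonormalBasis_extension_of_card_eq (ι := Fin 2) (by simp)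
  have hb0 : b 0 = v 0 := hb 0 trivial
  have hb1 : b 1 = v 1 := hb 1 trivial
  refine ⟨b, fun a d => ?_⟩
  simp only [Fin.forall_fin_two, coord_eq, hb0, hb1]
  refine and_congr (nonneg_iff_of_sq_mul (inv_ne_zero hn0) ?_)
    (nonneg_iff_of_sq_mul (inv_ne_zero hn0) ?_) <;> simp [hv] <;> field_simp
  all_goals ring

theorem rootedUniform2DMonotone_iff (G : GeometricGraph P) (r : P) :
    RootedUniform2DMonotone G r ↔ ∃ t, 0 ≤ t ∧ t ≤ 1 ∧ ∀ p ≠ r, ∃ q, G.Adj q p ∧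
      SameQuadrant t ((q : Plane) - r) ((p : Plane) - q) := by
  simp only [RootedUniform2DMonotone, rootedXYMonotone_iff, ← coord_sub]
  constructor
  · rintro ⟨b, h⟩
    obtain ⟨t, h0, h1, ht⟩ := exists_param b
    simp only [ht] at h
    exact ⟨t, h0, h1, h⟩
  · rintro ⟨t, -, -, h⟩
    obtain ⟨b, hb⟩ := exists_system t
    simp only [← hb] at h
    exact ⟨b, h⟩

end Geom

namespace Geom

open RealRAM

variable {P : Finset Plane} {G : GeometricGraph P}

/-! ### The decision program -/

theorem exists_sign_iff {x y : ℝ} :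
    (∃ σ : ℤ, (σ = 1 ∨ σ = -1) ∧ 0 ≤ (σ : ℝ) * x ∧ 0 ≤ (σ : ℝ) * y) ↔ 0 ≤ x * y := by
  rw [mul_nonneg_iff]
  constructor
  · rintro ⟨σ, rfl | rfl, h1, h2⟩
    · left; simpa using And.intro h1 h2
    · right; simpa using And.intro h1 h2
  · rintro (h | h)
    · exact ⟨1, by simpa using h⟩
    · exact ⟨-1, by simpa using h⟩

/-- The product conditions are quadratic in `t`; fixing the common signs splits them into affine
inequalities, one system per quadrant. -/
theorem sameQuadrant_iff {t : ℝ} {a d : Plane} : (0 ≤ t ∧ t ≤ 1 ∧ SameQuadrant t a d) ↔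
    ∃ σ : ℤ, (σ = 1 ∨ σ = -1) ∧ ∃ τ : ℤ, (τ = 1 ∨ τ = -1) ∧
      InQuadrant σ τ (a 0) (a 1) (d 0) (d 1) t := by
  rw [SameQuadrant, ← exists_sign_iff, ← exists_sign_iff]
  constructor
  · rintro ⟨h0, h1, ⟨σ, hσ, h2, h3⟩, τ, hτ, h4, h5⟩
    exact ⟨σ, hσ, τ, hτ, h0, h1, h2, h3, h4, h5⟩
  · rintro ⟨σ, hσ, τ, hτ, h⟩
    exact ⟨h.nonneg, h.le_one, ⟨σ, hσ, h.fst_x, h.snd_x⟩, τ, hτ, h.fst_y, h.snd_y⟩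

theorem exists_mem_cases_iff {Q : ℕ → ℕ → ℤ → ℤ → Prop} :
    (∃ c ∈ cases, Q c.1 c.2.1 c.2.2.1 c.2.2.2) ↔
      (∃ σ : ℤ, (σ = 1 ∨ σ = -1) ∧ ∃ τ : ℤ, (τ = 1 ∨ τ = -1) ∧ Q 0 1 σ τ) ∨
      ∃ σ : ℤ, (σ = 1 ∨ σ = -1) ∧ ∃ τ : ℤ, (τ = 1 ∨ τ = -1) ∧ Q 1 0 σ τ := by
  simp only [cases, List.exists_mem_cons_iff, List.not_mem_nil, false_and, exists_false, or_false,
    or_and_right, exists_or, exists_eq_left, or_assoc]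

/-- Since the ends of an edge are listed in arbitrary order, both orientations must be tried to meet
every neighbour of a vertex. -/
theorem Listing.exists_edge_iff (L : Listing G) (r : P) (v : Fin P.card) (t : ℝ) :
    (∃ j < numEdges G, ∃ c ∈ cases, (v : ℕ) = (L.initial r).natArr c.1 j ∧
      Admits (L.initial r) j c.1 c.2.1 c.2.2.1 c.2.2.2 t) ↔
    0 ≤ t ∧ t ≤ 1 ∧ ∃ q, G.Adj q (L.vertex v) ∧
      SameQuadrant t ((q : Plane) - r) ((L.vertex v : Plane) - q) := by
  have hr : ((L.initial r).natReg 2) = L.vertex.symm r := rfl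
  have hsrc : ∀ j : Fin (numEdges G), (L.initial r).natArr 0 j = L.src j := fun j => by
    simp [Listing.initial]
  have htgt : ∀ j : Fin (numEdges G), (L.initial r).natArr 1 j = L.tgt j := fun j => by
    simp [Listing.initial]
  have hX : ∀ i : Fin P.card, (L.initial r).realArr 0 i = (L.vertex i : Plane) 0 := fun i => by
    simp [Listing.initial]
  have hY : ∀ i : Fin P.card, (L.initial r).realArr 1 i = (L.vertex i : Plane) 1 := fun i => by
    simp [Listing.initial]
  have hadm : ∀ (j : Fin (numEdges G)) (a b : ℕ) (x y : Fin P.card),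
      (L.initial r).natArr a j = x → (L.initial r).natArr b j = y →
      ((∃ σ : ℤ, (σ = 1 ∨ σ = -1) ∧ ∃ τ : ℤ, (τ = 1 ∨ τ = -1) ∧
        (v : ℕ) = (L.initial r).natArr a j ∧ Admits (L.initial r) j a b σ τ t) ↔
      v = x ∧ 0 ≤ t ∧ t ≤ 1 ∧
        SameQuadrant t ((L.vertex y : Plane) - r) ((L.vertex x : Plane) - L.vertex y)) := by
    intro j a b x y hx hy
    rw [sameQuadrant_iff]
    simp only [Admits, hx, hy, hr, hX, hY, Equiv.apply_symm_apply, PiLp.sub_apply, Fin.val_inj]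
    constructor
    · rintro ⟨σ, hσ, τ, hτ, hv, h⟩
      exact ⟨hv, σ, hσ, τ, hτ, h⟩
    · rintro ⟨hv, σ, hσ, τ, hτ, h⟩
      exact ⟨σ, hσ, τ, hτ, hv, h⟩
  have hadj : ∀ j, G.Adj (L.vertex (L.src j)) (L.vertex (L.tgt j)) := fun j => by
    have := (L.edge j).2
    rwa [L.edge_eq j, SimpleGraph.mem_edgeSet] at this
  constructor
  · rintro ⟨j, hj, h⟩
    rw [exists_mem_cases_iff (Q := fun a b σ τ => (v : ℕ) = (L.initial r).natArr a j ∧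
      Admits (L.initial r) j a b σ τ t), hadm ⟨j, hj⟩ 0 1 _ _ (hsrc ⟨j, hj⟩) (htgt ⟨j, hj⟩),
      hadm ⟨j, hj⟩ 1 0 _ _ (htgt ⟨j, hj⟩) (hsrc ⟨j, hj⟩)] at h
    rcases h with ⟨rfl, h0, h1, h⟩ | ⟨rfl, h0, h1, h⟩
    · exact ⟨h0, h1, _, (hadj _).symm, h⟩
    · exact ⟨h0, h1, _, hadj _, h⟩
  · rintro ⟨h0, h1, q, hq, h⟩
    obtain ⟨j, hj⟩ := L.edge.surjective ⟨s(q, L.vertex v), hq⟩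
    have e := L.edge_eq j
    rw [hj] at e
    refine ⟨j, j.2, ?_⟩
    rw [exists_mem_cases_iff (Q := fun a b σ τ => (v : ℕ) = (L.initial r).natArr a j ∧
      Admits (L.initial r) j a b σ τ t), hadm j 0 1 _ _ (hsrc j) (htgt j),
      hadm j 1 0 _ _ (htgt j) (hsrc j)]
    rcases Sym2.eq_iff.mp e with ⟨rfl, hv⟩ | ⟨rfl, hv⟩
    · obtain rfl := L.vertex.injective hv
      exact .inr ⟨rfl, h0, h1, h⟩
    · obtain rfl := L.vertex.injective hv
      exact .inl ⟨rfl, h0, h1, h⟩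

/-- An edge is determined by its pair of end numbers. This bound turns `log |E|` into `O(log |P|)`.
-/
theorem Listing.numEdges_le (L : Listing G) : numEdges G ≤ P.card * P.card := by
  have : Function.Injective fun j => (L.src j, L.tgt j) := by
    intro i j hij
    rw [Prod.mk.injEq] at hij
    refine L.edge.injective (Subtype.ext ?_)
    rw [L.edge_eq, L.edge_eq, hij.1, hij.2]
  simpa using Fintype.card_le_of_injective _ this

/-- The program that decides whether a rooted geometric graph is rooted uniform 2D-monotone. -/
def decide2DMonotone : Program := .seq collect sweep

theorem decide2DMonotone_runs (L : Listing G) (r : P) {k : ℕ}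
    (hk : 2 * (8 * numEdges G) ≤ 2 ^ k) :
    Runs decide2DMonotone (L.initial r)
      (12 + (numEdges G * (edgeStep.bound + 3) + 3) + (4 + (2 * (8 * numEdges G) *
        (fillStep.bound + buildStep.bound + 6) + 10 + (sweepInit.bound +
        (2 * (8 * numEdges G) * (sweepItem.bound + (k * (repairStep.bound + 3) + 3) + 3) + 3 + 2)))))
      (fun s => (s.natReg 0 = 0 ∨ s.natReg 0 = 1) ∧
        (s.natReg 0 = 1 ↔ RootedUniform2DMonotone G r)) := by
  have hr : (L.vertex.symm r : ℕ) < P.card := (L.vertex.symm r).2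
  refine Runs.seq (collect_runs hr rfl rfl rfl rfl rfl fun j hj => ?_) ?_
  · simp [Listing.initial, hj]
  rintro s ⟨h0, h2, h5, h14, hA, hI, hcov⟩
  refine (sweep_runs hI hr h0 h2 h5 (by rw [h14]; rfl) rfl rfl (by rw [hA]; simp [Listing.initial])
    hk).mono le_rfl ?_
  rintro s' ⟨h, h'⟩
  refine ⟨h, h'.trans ?_⟩
  rw [rootedUniform2DMonotone_iff]
  refine exists_congr fun t => and_congr_right fun ht0 => and_congr_right fun ht1 => ?_
  have key : ∀ v : Fin P.card, L.vertex v ≠ r →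
      (Covers (8 * numEdges G) (s.natArr 2) (s.realArr 2) v t ↔ ∃ q, G.Adj q (L.vertex v) ∧
        SameQuadrant t ((q : Plane) - r) ((L.vertex v : Plane) - q)) := by
    intro v hv
    rw [hcov v (fun e => hv (by
      rw [← L.vertex.apply_symm_apply r]
      exact congrArg _ (Fin.ext e))) t, L.exists_edge_iff]
    simp only [ht0, ht1, true_and]
  constructor
  · intro hall p hp
    obtain ⟨v, rfl⟩ := L.vertex.surjective p
    refine (key v hp).mp (hall v v.2 fun e => hp ?_)
    rw [← L.vertex.apply_symm_apply r]
    exact congrArg _ (Fin.ext e)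
  · intro hall v hv hvr
    have hne : L.vertex ⟨v, hv⟩ ≠ r := by
      rintro rfl
      simp at hvr
    exact (key ⟨v, hv⟩ hne).mpr (hall _ hne)

/-- Needed so that the fixed overhead of the program is absorbed by `|E| log |P|`. -/
theorem one_le_numEdges (hG : G.Connected) (hP : 2 ≤ P.card) : 1 ≤ numEdges G := by
  have := hG.card_vert_le_card_edgeSet_add_one
  rw [Nat.card_coe_set_eq, Nat.card_eq_fintype_card, Fintype.card_coe] at this
  unfold numEdges
  omega

end Geom

/-! ### The final step bound. -/

/-- A single real RAM program decides, in `O(|E| log |P|)` steps, whether a rooted connected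
geometric graph is rooted uniform 2D-monotone: it always halts, with answer `1` (yes) or `0` (no)
in natural number register `0`. (For `|P| = 1`, where `|E| log |P| = 0`, no step bound is meant.) -/
theorem mainTheorem8 :
    ∃ (prog : RealRAM.Program) (C : ℝ),
      ∀ (P : Finset Geom.Plane) (G : Geom.GeometricGraph P) (r : P) (L : Geom.Listing G),
        G.Connected →
          ∃ (s : RealRAM.State) (t : ℕ),
            RealRAM.Exec prog (L.initial r) s t ∧
            (Geom.RootedUniform2DMonotone G r → s.natReg 0 = 1) ∧
            (¬ Geom.RootedUniform2DMonotone G r → s.natReg 0 = 0) ∧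
            (2 ≤ P.card →
              (t : ℝ) ≤ C * ((Geom.numEdges G : ℝ) * Real.log (P.card : ℝ))) := by
  obtain ⟨A, hA⟩ : ∃ A, A = RealRAM.edgeStep.bound + 3 := ⟨_, rfl⟩
  obtain ⟨B, hB⟩ : ∃ B, B = RealRAM.fillStep.bound + RealRAM.buildStep.bound + 6 := ⟨_, rfl⟩
  obtain ⟨D, hD⟩ : ∃ D, D = RealRAM.repairStep.bound + 3 := ⟨_, rfl⟩
  set F := RealRAM.sweepItem.bound with hF
  set I := RealRAM.sweepInit.bound with hI
  refine ⟨Geom.decide2DMonotone,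
    ((34 + A + 16 * B + I + 16 * (F + 8 * D + 6) : ℕ) : ℝ) / Real.log 2,
    fun P G r L hG => ?_⟩
  set E := Geom.numEdges G with hE
  set l := Nat.log 2 P.card with hl
  have hP : P.card < 2 ^ (l + 1) := Nat.lt_pow_succ_log_self one_lt_two _
  -- From `E ≤ |P| ^ 2` and `|P| < 2 ^ (l + 1)`; the factor `16` contributes four of the six extra
  -- levels.
  have hk : 2 * (8 * E) ≤ 2 ^ (2 * l + 6) := by
    calc 2 * (8 * E) ≤ 16 * (P.card * P.card) := by linarith [L.numEdges_le]
      _ ≤ 16 * (2 ^ (l + 1) * 2 ^ (l + 1)) := by gcongr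
      _ = 2 ^ (2 * l + 6) := by ring
  obtain ⟨s, t, h1, h2, h3, h4⟩ := Geom.decide2DMonotone_runs L r hk
  refine ⟨s, t, h1, h4.mpr, fun h => h3.resolve_right fun h' => h (h4.mp h'), fun hP2 => ?_⟩
  have hE1 : 1 ≤ E := Geom.one_le_numEdges hG hP2
  have hl1 : 1 ≤ l := Nat.log_pos one_lt_two hP2
  have hEl : E ≤ E * l := Nat.le_mul_of_pos_right _ hl1
  have ht : t ≤ (34 + A + 16 * B + I + 16 * (F + 8 * D + 6)) * (E * l) := by
    rw [← hA, ← hB, ← hD] at h2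
    have e1 : 1 ≤ E * l := hE1.trans hEl
    calc t ≤ _ := h2
      -- Here `34` collects the constants outside the loops. As `1 ≤ l` and `1 ≤ E`, it is at most
      -- `34 * (E * l)`, and `2 * l + 6 ≤ 8 * l` gives the coefficient `8 * D`.
      _ = 34 + I + E * A + E * (16 * B) + E * (16 * (F + 6)) + E * (16 * ((2 * l + 6) * D)) := by
        ring
      _ ≤ 34 * (E * l) + I * (E * l) + E * l * A + E * l * (16 * B) + E * l * (16 * (F + 6)) +
          E * (16 * ((2 * l + 6 * l) * D)) := by
        gcongr
        · omega
        · exact Nat.le_mul_of_pos_right _ e1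
        · omega
      _ = _ := by ring
  have hlog2 : 0 < Real.log 2 := Real.log_pos one_lt_two
  have hll : (l : ℝ) ≤ Real.log P.card / Real.log 2 := by
    have := Real.natLog_le_logb P.card 2
    rwa [Real.logb] at this
  calc (t : ℝ) ≤ ((34 + A + 16 * B + I + 16 * (F + 8 * D + 6) : ℕ) : ℝ) * (E * l) := by
        exact_mod_cast ht
    _ ≤ ((34 + A + 16 * B + I + 16 * (F + 8 * D + 6) : ℕ) : ℝ) *
        (E * (Real.log P.card / Real.log 2)) := by gcongr
    _ = _ := by ring
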